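/- Let $(X,\mathcal B,\mu)$ be a standard probability space. An automorphism of $(X,\mu)$ is an invertible bimeasurable $\mu$-preserving transformation, and automorphisms that agree almost everywhere are identified. Fix a sequence $\{A_i\}$ of measurable sets dense in $\mathcal B$ (with respect to $\mu(\cdot\,\Delta\,\cdot)$) and let $$\rho(S,T)=\sum_i 2^{-i}\bigl(\mu(SA_i\,\Delta\, TA_i)+\mu(S^{-1}A_i\,\Delta\, T^{-1}A_i)\bigr)$$ be the Halmos metric on $\mathrm{Aut}(\mu)$; the Halmos metric on $\mathrm{Aut}(\mu\otimes\mu)$ is defined in the same way from a dense sequence of measurable subsets of $X\times X$. Let $S$ be a weakly mixing automorphism of $(X,\mu)$, i.e. there is a sequence $j_k\to\infty$ with $\mu(A\cap S^{j_k}B)\to\mu(A)\mu(B)$ for all $A,B\in\mathcal B$. Let $\mathrm{Ext}(S)\subset\mathrm{Aut}(\mu\otimes\mu)$ be the space of all skew products $R(x,y)=(Sx,R_xy)$ on $X\times X$, where $\{R_x\}$ is a measurable family of automorphisms of $(X,\mu)$, with the induced Halmos metric. A typical (generic) $R\in\mathrm{Ext}(S)$ is said to have a property if the set of extensions with this property contains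 a dense $G_\delta$ subset of $\mathrm{Ext}(S)$. Put $C(x,n,R)=R_{S^{n-1}x}\cdots R_{Sx}R_x$. For a sequence of finite sets $P_j\subset\mathbb N$ and $A\in\mathcal B$ with $\mu(A)>0$ let $$\varphi_A(N,j,R)=\prod_{p\in P_j}\mu\Bigl(x\in A:\ S^px\in A,\ \rho(C(x,p,R),\mathrm{Id})<\tfrac1N\Bigr),$$ and let $RC(P_j,A)$ be the class of all $R\in\mathrm{Ext}(S)$ such that for all $N\ge 1$ and $j_0$ there is $j>j_0$ with $\varphi_A(N,j,R)>0$. **Theorem.** For every measurable set $A$ with $\mu(A)>0$ there is a sequence of sets $P_j\subset\{j,j+1,\dots,2j\}$ with $|P_j|/j\to1$ as $j\to\infty$ such that a typical $R\in\mathrm{Ext}(S)$ belongs to $RC(P_j,A)$. **Corollary.** A typical $R\in\mathrm{Ext}(S)$ has the following property: for every measurable set $A$ with $\mu(A)>0$ and almost every $x\in A$ there is a sequence $p_i\to\infty$ (depending on $x$) such that $S^{p_i}x\in A$ for all $i$ and $C(x,p_i,R)\to\mathrm{Id}$ in the metric $\rho$. -/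

import Mathlib

open MeasureTheory Filter Topology

open scoped symmDiff

namespace GenericExtension

/-- An automorphism of the measure space `(X, μ)`: an invertible bimeasurable transformation
preserving `μ`.  Automorphisms which agree almost everywhere are at Halmos distance zero
(see `halmosDist`), i.e. they are identified by the pseudometric. -/
structure Automorphism {X : Type*} [MeasurableSpace X] (μ : Measure X) extends X ≃ᵐ X where
  /-- the transformation preserves the measure -/
  preserves : MeasurePreserving toEquiv μ μ

namespace Automorphism

variable {X : Type*} [MeasurableSpace X] {μ : Measure X}

instance : CoeFun (Automorphism μ) (fun _ => X → X) := ⟨fun T => T.toEquiv⟩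

/-- The inverse transformation, as a function. -/
def invFun' (T : Automorphism μ) : X → X := T.toEquiv.symm

/-- The identity automorphism `Id`. -/
def one (μ : Measure X) : Automorphism μ where
  toMeasurableEquiv := MeasurableEquiv.refl X
  preserves := MeasurePreserving.id μ

/-- The composition `T ∘ S` of automorphisms, `x ↦ T (S x)`. -/
def comp (T S : Automorphism μ) : Automorphism μ where
  toMeasurableEquiv := S.toMeasurableEquiv.trans T.toMeasurableEquiv
  preserves := T.preserves.comp S.preserves

/-- Weak mixing: there is a mixing sequence `j k → ∞`, i.e. such that
`μ (A ∩ T^(j k) B) → μ A * μ B` for all measurable `A`, `B`. -/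
def IsWeaklyMixing (T : Automorphism μ) : Prop :=
  ∃ j : ℕ → ℕ, Tendsto j atTop atTop ∧
    ∀ A B : Set X, MeasurableSet A → MeasurableSet B →
      Tendsto (fun k => μ (A ∩ T^[j k] '' B)) atTop (𝓝 (μ A * μ B))

end Automorphism

section Halmos

variable {X : Type*} [MeasurableSpace X] {μ : Measure X}

/-- The Halmos distance
`ρ(S, T) = ∑ i, 2^(-i) (μ (S A_i ∆ T A_i) + μ (S⁻¹ A_i ∆ T⁻¹ A_i))` between automorphisms,
relative to a sequence of sets `A_i` (in use, a sequence which is dense in the measure algebra). -/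
noncomputable def halmosDist (A : ℕ → Set X) (S T : Automorphism μ) : ℝ :=
  ∑' i : ℕ, (1 / 2 : ℝ) ^ i *
    (μ.real ((S '' A i) ∆ (T '' A i)) + μ.real ((S.invFun' '' A i) ∆ (T.invFun' '' A i)))

theorem summable_halmosDist [IsProbabilityMeasure μ] (A : ℕ → Set X) (S T : Automorphism μ) :
    Summable fun i : ℕ => (1 / 2 : ℝ) ^ i *
      (μ.real ((S '' A i) ∆ (T '' A i)) +
        μ.real ((S.invFun' '' A i) ∆ (T.invFun' '' A i))) := by
  refine Summable.of_nonneg_of_le (fun i => by positivity) (fun i => ?_)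
    (summable_geometric_two.mul_right 2)
  have h1 : μ.real ((S '' A i) ∆ (T '' A i)) ≤ 1 := measureReal_le_one
  have h2 : μ.real ((S.invFun' '' A i) ∆ (T.invFun' '' A i)) ≤ 1 := measureReal_le_one
  gcongr
  linarith

/-- The Halmos distance is a pseudometric on automorphisms (two automorphisms which agree almost
everywhere are at distance zero). -/
noncomputable abbrev halmosPseudoMetric [IsProbabilityMeasure μ] (A : ℕ → Set X) :
    PseudoMetricSpace (Automorphism μ) where
  dist := halmosDist A
  dist_self S := by simp [halmosDist]
  dist_comm S T := by simp only [halmosDist, symmDiff_comm]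
  dist_triangle S T U := by
    change halmosDist A S U ≤ halmosDist A S T + halmosDist A T U
    unfold halmosDist
    rw [← (summable_halmosDist A S T).tsum_add (summable_halmosDist A T U)]
    refine (summable_halmosDist A S U).tsum_le_tsum (fun i => ?_)
      ((summable_halmosDist A S T).add (summable_halmosDist A T U))
    have tri : ∀ s t u : Set X, μ.real (s ∆ u) ≤ μ.real (s ∆ t) + μ.real (t ∆ u) := fun s t u =>
      (measureReal_mono (symmDiff_triangle s t u)).trans (measureReal_union_le _ _)
    rw [← mul_add]
    refine mul_le_mul_of_nonneg_left ?_ (by positivity)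
    linarith [tri (S '' A i) (T '' A i) (U '' A i),
      tri (S.invFun' '' A i) (T.invFun' '' A i) (U.invFun' '' A i)]

end Halmos

/-- The space `Ext(S)`: skew products `R (x, y) = (S x, R_x y)` on `(X × X, μ ⊗ μ)` over `S`,
given by a measurable family `x ↦ R_x` of automorphisms of `(X, μ)`. -/
structure Extension {X : Type*} [MeasurableSpace X] {μ : Measure X} (S : Automorphism μ) where
  /-- the automorphism `R_x` in the fibre over `x` -/
  fiber : X → Automorphism μ
  /-- joint measurability of `(x, y) ↦ R_x y` -/
  measurable_fiber : Measurable fun p : X × X => fiber p.1 p.2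

namespace Extension

variable {X : Type*} [MeasurableSpace X] {μ : Measure X} {S : Automorphism μ}

/-- The bijection `(x, y) ↦ (S x, R_x y)` of `X × X`. -/
def toEquiv (R : Extension S) : X × X ≃ X × X where
  toFun p := (S p.1, R.fiber p.1 p.2)
  invFun p := (S.invFun' p.1, (R.fiber (S.invFun' p.1)).invFun' p.2)
  left_inv p := by simp [Automorphism.invFun']
  right_inv p := by simp [Automorphism.invFun']

theorem measurable_toEquiv (R : Extension S) : Measurable R.toEquiv :=
  (S.preserves.measurable.comp measurable_fst).prodMk R.measurable_fiber

theorem measurable_toEquiv_symm [StandardBorelSpace X] (R : Extension S) :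
    Measurable R.toEquiv.symm := by
  have h := R.measurable_toEquiv.measurableEmbedding R.toEquiv.injective
  rw [← h.measurable_comp_iff]
  simpa using measurable_id

/-- The skew product `(x, y) ↦ (S x, R_x y)` as an automorphism of `(X × X, μ ⊗ μ)`. -/
def toAutomorphism [StandardBorelSpace X] [IsProbabilityMeasure μ] (R : Extension S) :
    Automorphism (μ.prod μ) where
  toEquiv := R.toEquiv
  measurable_toFun := R.measurable_toEquiv
  measurable_invFun := R.measurable_toEquiv_symm
  preserves := S.preserves.skew_product (g := fun x y => R.fiber x y) R.measurable_fiber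
    (ae_of_all _ fun x => (R.fiber x).preserves.map_eq)

/-- The cocycle `C(x, n, R) = R_{S^(n-1) x} ⋯ R_{S x} R_x`. -/
def cocycle (R : Extension S) (x : X) : ℕ → Automorphism μ
  | 0 => Automorphism.one μ
  | n + 1 => (R.fiber (S^[n] x)).comp (R.cocycle x n)

/-- A set `W` of extensions is typical if it contains a `G_δ` set which is dense in `Ext(S)`,
where `Ext(S)` carries the Halmos metric of the automorphisms of `(X × X, μ ⊗ μ)` (relative to
the sequence `B` of subsets of `X × X`). -/
def IsTypical [StandardBorelSpace X] [IsProbabilityMeasure μ] (B : ℕ → Set (X × X))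
    (W : Set (Extension S)) : Prop :=
  letI : PseudoMetricSpace (Extension S) :=
    PseudoMetricSpace.induced toAutomorphism (halmosPseudoMetric B)
  ∃ G : Set (Extension S), G ⊆ W ∧ IsGδ G ∧ Dense G

/-- The function
`φ_A(N, j, R) = ∏_{p ∈ P_j} μ {x | x ∈ A, S^p x ∈ A, ρ(C(x, p, R), Id) < 1 / N}`,
where `ρ` is the Halmos distance relative to the sequence `F` of subsets of `X`. -/
noncomputable def phi (F : ℕ → Set X) (P : ℕ → Finset ℕ) (A : Set X) (N j : ℕ)
    (R : Extension S) : ℝ :=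
  ∏ p ∈ P j, μ.real {x | x ∈ A ∧ S^[p] x ∈ A ∧
    halmosDist F (R.cocycle x p) (Automorphism.one μ) < 1 / (N : ℝ)}

/-- The class `RC(P_j, A)`. -/
def RC (S : Automorphism μ) (F : ℕ → Set X) (P : ℕ → Finset ℕ) (A : Set X) :
    Set (Extension S) :=
  {R | ∀ N : ℕ, 1 ≤ N → ∀ j₀ : ℕ, ∃ j > j₀, 0 < phi F P A N j R}

end Extension

end GenericExtension

/-! Both claims are Baire-type arguments: a recurrence property is shown to hold on a neighbourhood
of every member of one dense set of extensions, and a countable intersection of interiors is the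
required `G_δ`.

The dense set consists of return-trivial extensions. For a coboundary `R_x = ψ(Sx) ψ(x)⁻¹` the
cocycle telescopes to `ψ(S^p x) ψ(x)⁻¹`. By separability the base is a countable union of pieces on
which `ψ` is nearly constant, so every return to a piece gives a cocycle near the identity
(`isReturnTrivial_coboundary`). Unless the measure is trivial, in which case every extension is
return-trivial, any `R` agrees with a coboundary off a set of small measure
(`exists_coboundary_agree`).

Such returns survive perturbation because, for fixed `p`, Halmos convergence of extensions forces
the `p`-step cocycles to converge in measure (`tendsto_measureReal_not_almostFixes`). Finitely many
times `p` are controlled at once.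

For the theorem, weak mixing makes `S × S` ergodic, hence `μ(F ∩ S⁻ᵖF) → μ(F)²` in quadratic Cesàro
mean. Summing over a dense sequence of sets gives windows `P_j`, independent of `A`, that eventually
consist of return times of any given set of positive measure (`exists_windows_measure_inter_pos`).
For the corollary one typical set must serve uncountably many `A`, so the windows are replaced by
Poincaré recurrence with bounds depending only on a lower bound for `μ(A)`
(`IsReturnTrivial.eventually_isRecurrentAt`). -/

namespace GenericExtension

/-! ### Mean ergodic theorem for correlations -/

section Ergodic

variable {Y : Type*} [MeasurableSpace Y] {ν : Measure Y} [IsProbabilityMeasure ν]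

theorem tendsto_average_measureReal_inter {T : Y → Y} (hT : Ergodic T ν) {A : Set Y}
    (hA : MeasurableSet A) :
    Tendsto (fun n : ℕ => (n : ℝ)⁻¹ * ∑ p ∈ Finset.range n, ν.real (A ∩ T^[p] ⁻¹' A))
      atTop (𝓝 (ν.real A ^ 2)) := by
  have hmp := hT.toMeasurePreserving
  set U : Lp ℝ 2 ν →L[ℝ] Lp ℝ 2 ν :=
    (Lp.compMeasurePreservingₗᵢ ℝ T hmp).toContinuousLinearMap with hU
  have hU1 : ‖U‖ ≤ 1 := LinearIsometry.norm_toContinuousLinearMap_le _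
  set f : Lp ℝ 2 ν := indicatorConstLp 2 hA (measure_ne_top ν A) 1 with hf
  set e : Lp ℝ 2 ν := indicatorConstLp 2 .univ (measure_ne_top ν Set.univ) 1 with he
  have hUf : ∀ p : ℕ, U^[p] f =
      indicatorConstLp 2 ((hmp.iterate p).measurable hA) (measure_ne_top ν _) (1 : ℝ) := by
    intro p
    induction p with
    | zero => simp [hf]
    | succ p ih =>
      rw [Function.iterate_succ_apply', ih]
      have := Lp.indicatorConstLp_compMeasurePreserving (p := 2)
        ((hmp.iterate p).measurable hA) (measure_ne_top ν _) (1 : ℝ) hmp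
      exact this
  have hUe : U e = e :=
    Lp.indicatorConstLp_compMeasurePreserving (p := 2) MeasurableSet.univ
      (measure_ne_top ν _) (1 : ℝ) hmp
  set g := (U.eqLocus (1 : Lp ℝ 2 ν →L[ℝ] Lp ℝ 2 ν)).orthogonalProjectionOnto f with hg
  have key := U.tendsto_birkhoffAverage_orthogonalProjection hU1 f
  have hin := key.inner (tendsto_const_nhds (x := f)) (𝕜 := ℝ)
  have hgU : U g = g := g.2
  -- The limit is `U`-invariant, hence constant by ergodicity; pairing with the invariant function
  -- `e = 1` identifies the constant.
  obtain ⟨c, hc⟩ := hT.eq_const_of_compMeasurePreserving_eq (g := (g : Lp ℝ 2 ν).1)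
    (congrArg Subtype.val hgU)
  have hgc : (g : Lp ℝ 2 ν) = indicatorConstLp 2 .univ (measure_ne_top ν Set.univ) c := by
    rw [indicatorConstLp_univ]
    exact Subtype.ext hc
  have hc1 : c = ν.real A := by
    have h1 : inner ℝ (g : Lp ℝ 2 ν) e = inner ℝ f e :=
      Submodule.inner_orthogonalProjectionOnto_eq_of_mem_right (𝕜 := ℝ)
        (K := U.eqLocus (1 : Lp ℝ 2 ν →L[ℝ] Lp ℝ 2 ν)) ⟨e, hUe⟩ f
    rw [hgc, hf, he, L2.inner_indicatorConstLp_indicatorConstLp,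
      L2.inner_indicatorConstLp_indicatorConstLp] at h1
    simpa using h1
  have hlim : inner ℝ (g : Lp ℝ 2 ν) f = ν.real A ^ 2 := by
    rw [hgc, hf, L2.inner_indicatorConstLp_indicatorConstLp, hc1]
    simp [sq]
  rw [hlim] at hin
  refine hin.congr fun n => ?_
  simp only [birkhoffAverage, birkhoffSum, id, real_inner_smul_left, sum_inner]
  congr 1
  refine Finset.sum_congr rfl fun p _ => ?_
  rw [hUf, hf, L2.real_inner_indicatorConstLp_one_indicatorConstLp_one, Set.inter_comm]

end Ergodic

/-! ### Mixing along a sequence, and products -/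

/-- Convergence on a generating `π`-system of uniformly dominated measures to a multiple of the
dominating measure. -/
theorem tendsto_measureReal_of_piSystem {Y : Type*} [mY : MeasurableSpace Y] {ν : Measure Y}
    [IsFiniteMeasure ν] {s : Set (Set Y)} (hgen : mY = MeasurableSpace.generateFrom s)
    (hpi : IsPiSystem s) {m : ℕ → Measure Y} (hm : ∀ k, m k ≤ ν) {c : ℝ}
    (huniv : Tendsto (fun k => (m k).real Set.univ) atTop (𝓝 (c * ν.real Set.univ)))
    (hs : ∀ t ∈ s, Tendsto (fun k => (m k).real t) atTop (𝓝 (c * ν.real t)))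
    {E : Set Y} (hE : MeasurableSet E) :
    Tendsto (fun k => (m k).real E) atTop (𝓝 (c * ν.real E)) := by
  have hfin : ∀ k, IsFiniteMeasure (m k) := fun k => isFiniteMeasure_of_le ν (hm k)
  induction E, hE using MeasurableSpace.induction_on_inter hgen hpi with
  | empty => simp
  | basic t ht => exact hs t ht
  | compl t ht ih =>
    simp_rw [measureReal_compl ht, mul_sub]
    exact huniv.sub ih
  | iUnion f hd hf ih =>
    have key : ∀ (θ : Measure Y) [IsFiniteMeasure θ], θ.real (⋃ i, f i) = ∑' i, θ.real (f i) := by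
      intro θ _
      rw [measureReal_def, measure_iUnion hd hf,
        ENNReal.tsum_toReal_eq fun i => measure_ne_top θ _]
      rfl
    simp_rw [key, ← tsum_mul_left]
    refine tendsto_tsum_of_dominated_convergence (bound := fun i => ν.real (f i)) ?_ ih ?_
    · exact ENNReal.summable_toReal
        (by rw [← measure_iUnion hd hf]; exact measure_ne_top ν _)
    · refine .of_forall fun k i => ?_
      rw [Real.norm_of_nonneg measureReal_nonneg]
      exact ENNReal.toReal_mono (measure_ne_top ν _) (hm k _)

theorem ergodic_of_mixing_sequence {Y : Type*} [MeasurableSpace Y] {ν : Measure Y}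
    [IsProbabilityMeasure ν] {T : Y → Y} (hT : MeasurePreserving T ν ν) (j : ℕ → ℕ)
    (h : ∀ E, MeasurableSet E →
      Tendsto (fun k => ν.real (E ∩ T^[j k] ⁻¹' E)) atTop (𝓝 (ν.real E * ν.real E))) :
    Ergodic T ν := by
  refine ⟨hT, ⟨fun E hE hTE => ?_⟩⟩
  have hit : ∀ n : ℕ, T^[n] ⁻¹' E = E := by
    intro n
    induction n with
    | zero => rfl
    | succ n ih => rw [Function.iterate_succ, Set.preimage_comp, ih, hTE]
  have h1 := h E hE
  simp only [hit, Set.inter_self] at h1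
  have h2 : ν.real E = ν.real E * ν.real E := tendsto_nhds_unique tendsto_const_nhds h1
  rw [eventuallyConst_set']
  have h3 : ν.real E = 0 ∨ ν.real E = 1 := by
    rcases eq_or_ne (ν.real E) 0 with h0 | h0
    · exact .inl h0
    · exact .inr (mul_left_cancel₀ h0 (by rw [mul_one]; exact h2.symm))
  rcases h3 with h3 | h3
  · left
    rw [measureReal_eq_zero_iff] at h3
    exact ae_eq_empty.2 h3
  · right
    rw [ae_eq_univ, prob_compl_eq_zero_iff hE]
    simpa [measureReal_def, ENNReal.toReal_eq_one_iff] using h3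

section Product

variable {X : Type*} [MeasurableSpace X] {μ : Measure X} [IsProbabilityMeasure μ]

/-- On rectangles the correlations factor. The π-system argument then extends this to general `E'`
with a rectangle on the left, and afterwards to general `E`. -/
theorem prod_mixing_sequence {T : X → X} (hT : MeasurePreserving T μ μ) (j : ℕ → ℕ)
    (h : ∀ A B : Set X, MeasurableSet A → MeasurableSet B →
      Tendsto (fun k => μ.real (A ∩ T^[j k] ⁻¹' B)) atTop (𝓝 (μ.real A * μ.real B)))
    {E E' : Set (X × X)} (hE : MeasurableSet E) (hE' : MeasurableSet E') :
    Tendsto (fun k => (μ.prod μ).real (E ∩ (Prod.map T T)^[j k] ⁻¹' E')) atTop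
      (𝓝 ((μ.prod μ).real E * (μ.prod μ).real E')) := by
  have hTT : MeasurePreserving (Prod.map T T) (μ.prod μ) (μ.prod μ) := hT.prod hT
  have hmeas : ∀ n {G : Set (X × X)}, MeasurableSet G →
      MeasurableSet ((Prod.map T T)^[n] ⁻¹' G) := fun n G hG => (hTT.iterate n).measurable hG
  have hpres : ∀ n {G : Set (X × X)}, MeasurableSet G →
      (μ.prod μ).real ((Prod.map T T)^[n] ⁻¹' G) = (μ.prod μ).real G := fun n G hG =>
    (hTT.iterate n).measureReal_preimage hG.nullMeasurableSet
  have step1 : ∀ A B A' B' : Set X, MeasurableSet A → MeasurableSet B → MeasurableSet A' →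
      MeasurableSet B' →
      Tendsto (fun k => (μ.prod μ).real (A ×ˢ B ∩ (Prod.map T T)^[j k] ⁻¹' (A' ×ˢ B'))) atTop
      (𝓝 ((μ.prod μ).real (A ×ˢ B) * (μ.prod μ).real (A' ×ˢ B'))) := by
    intro A B A' B' hA hB hA' hB'
    have h1 := (h A A' hA hA').mul (h B B' hB hB')
    convert! h1 using 2 with k
    · rw [← measureReal_prod_prod, Prod.map_iterate, Set.prod_inter_prod.symm]
      rfl
    · simp only [measureReal_prod_prod]; ring
  have step2 : ∀ A B : Set X, MeasurableSet A → MeasurableSet B →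
      Tendsto (fun k => (μ.prod μ).real (A ×ˢ B ∩ (Prod.map T T)^[j k] ⁻¹' E')) atTop
      (𝓝 ((μ.prod μ).real (A ×ˢ B) * (μ.prod μ).real E')) := by
    intro A B hA hB
    have hAB := hA.prod hB
    have heq : ∀ k {G : Set (X × X)}, MeasurableSet G →
        (((μ.prod μ).restrict (A ×ˢ B)).map ((Prod.map T T)^[j k])).real G =
          (μ.prod μ).real (A ×ˢ B ∩ (Prod.map T T)^[j k] ⁻¹' G) := by
      intro k G hG
      rw [map_measureReal_apply (hTT.iterate _).measurable hG,
        measureReal_restrict_apply (hmeas _ hG), Set.inter_comm]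
    have := tendsto_measureReal_of_piSystem (ν := μ.prod μ) generateFrom_prod.symm isPiSystem_prod
      (m := fun k => ((μ.prod μ).restrict (A ×ˢ B)).map ((Prod.map T T)^[j k]))
      (c := (μ.prod μ).real (A ×ˢ B)) ?_ ?_ ?_ hE'
    · simpa only [heq _ hE'] using this
    · intro k
      calc _ ≤ (μ.prod μ).map ((Prod.map T T)^[j k]) :=
            Measure.map_mono Measure.restrict_le_self (hTT.iterate _).measurable
        _ = _ := (hTT.iterate _).map_eq
    · simp only [heq _ MeasurableSet.univ]
      simp
    · rintro _ ⟨A', hA', B', hB', rfl⟩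
      simp only [heq _ (MeasurableSet.prod hA' hB')]
      exact step1 A B A' B' hA hB hA' hB'
  have heq : ∀ k {G : Set (X × X)}, MeasurableSet G →
        ((μ.prod μ).restrict ((Prod.map T T)^[j k] ⁻¹' E')).real G =
          (μ.prod μ).real (G ∩ (Prod.map T T)^[j k] ⁻¹' E') := by
      intro k G hG
      rw [measureReal_restrict_apply hG]
  have := tendsto_measureReal_of_piSystem (ν := μ.prod μ) generateFrom_prod.symm isPiSystem_prod
      (m := fun k => (μ.prod μ).restrict ((Prod.map T T)^[j k] ⁻¹' E'))
      (c := (μ.prod μ).real E') (fun _ => Measure.restrict_le_self) ?_ ?_ hE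
  · simpa only [heq _ hE, mul_comm] using this
  · simp only [heq _ MeasurableSet.univ, Set.univ_inter, hpres _ hE']
    simp
  · rintro _ ⟨A', hA', B', hB', rfl⟩
    simp only [heq _ (MeasurableSet.prod hA' hB')]
    rw [mul_comm]
    exact step2 A' B' hA' hB'

/-- If `T` and `T × T` are ergodic, then `μ (F ∩ T⁻ᵖ F)` converges to `μ(F)²` in the sense of
quadratic Cesàro means. -/
theorem tendsto_average_sq_of_ergodic_prod {T : X → X} (hT : Ergodic T μ)
    (hTT : Ergodic (Prod.map T T) (μ.prod μ)) {F : Set X} (hF : MeasurableSet F) :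
    Tendsto (fun n : ℕ => (n : ℝ)⁻¹ * ∑ p ∈ Finset.range n,
      (μ.real (F ∩ T^[p] ⁻¹' F) - μ.real F ^ 2) ^ 2) atTop (𝓝 0) := by
  have h1 := tendsto_average_measureReal_inter hT hF
  have h2 := tendsto_average_measureReal_inter hTT (hF.prod hF)
  have h3 : ∀ p : ℕ, (μ.prod μ).real (F ×ˢ F ∩ (Prod.map T T)^[p] ⁻¹' (F ×ˢ F)) =
      μ.real (F ∩ T^[p] ⁻¹' F) ^ 2 := by
    intro p
    rw [sq, ← measureReal_prod_prod, Prod.map_iterate, Set.prod_inter_prod.symm]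
    rfl
  simp only [h3, measureReal_prod_prod] at h2
  -- Expand the square: ergodicity of `T × T` controls the mean of the squared correlations, that of
  -- `T` the cross term.
  have h4 := (h2.sub (h1.const_mul (2 * μ.real F ^ 2))).add_const (μ.real F ^ 4)
  have h5 : (μ.real F * μ.real F) ^ 2 - 2 * μ.real F ^ 2 * μ.real F ^ 2 + μ.real F ^ 4 = 0 := by
    ring
  rw [h5] at h4
  refine h4.congr' ?_
  filter_upwards [eventually_gt_atTop 0] with n hn
  have hn' : (n : ℝ) ≠ 0 := by positivity
  simp only [sub_sq, Finset.sum_add_distrib, Finset.sum_sub_distrib, Finset.sum_const,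
    Finset.card_range, nsmul_eq_mul, ← Finset.sum_mul, ← Finset.mul_sum]
  field_simp

end Product

/-! ### Windows of return times -/

/-- A nonnegative sequence with Cesàro means tending to zero is uniformly small on subsets of the
windows `[j, 2j]` of density tending to one. -/
theorem exists_windows_of_average_tendsto_zero {b : ℕ → ℝ} (hb : ∀ p, 0 ≤ b p)
    (h : Tendsto (fun n : ℕ => (n : ℝ)⁻¹ * ∑ p ∈ Finset.range n, b p) atTop (𝓝 0)) :
    ∃ (P : ℕ → Finset ℕ) (s : ℕ → ℝ), (∀ j, P j ⊆ Finset.Icc j (2 * j)) ∧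
      Tendsto (fun j : ℕ => ((P j).card : ℝ) / (j : ℝ)) atTop (𝓝 1) ∧
      Tendsto s atTop (𝓝 0) ∧ ∀ j, ∀ p ∈ P j, b p ≤ s j := by
  set a : ℕ → ℝ := fun n => (n : ℝ)⁻¹ * ∑ p ∈ Finset.range n, b p with ha
  have ha0 : ∀ n, 0 ≤ a n := fun n =>
    mul_nonneg (by positivity) (Finset.sum_nonneg fun p _ => hb p)
  -- Chebyshev threshold: the sum of `b` over the window is at most `(2j+1) a(2j+1) ≤ 3j a(2j+1) = j
  -- s(j)²`, so at most `j s(j)` indices exceed `s j`.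
  set s : ℕ → ℝ := fun j => √(3 * a (2 * j + 1)) with hs
  have hs0 : Tendsto s atTop (𝓝 0) := by
    have h1 : Tendsto (fun j : ℕ => a (2 * j + 1)) atTop (𝓝 0) :=
      h.comp (tendsto_atTop_mono (fun j => by simp only [id]; omega) tendsto_id)
    have := (h1.const_mul 3).sqrt
    rwa [mul_zero, Real.sqrt_zero] at this
  have hsn : ∀ j, 0 ≤ s j := fun j => Real.sqrt_nonneg _
  refine ⟨fun j => (Finset.Icc j (2 * j)).filter (fun p => b p ≤ s j), s,
    fun j => Finset.filter_subset _ _, ?_, hs0, fun j p hp => (Finset.mem_filter.1 hp).2⟩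
  have hcard : ∀ j : ℕ, (Finset.Icc j (2 * j)).card = j + 1 := by
    intro j; rw [Nat.card_Icc]; omega
  have hbad : ∀ j : ℕ, 1 ≤ j →
      (((Finset.Icc j (2 * j)).filter (fun p => ¬ b p ≤ s j)).card : ℝ) ≤ j * s j := by
    intro j hj
    have hj' : (1 : ℝ) ≤ j := by exact_mod_cast hj
    set Q := (Finset.Icc j (2 * j)).filter (fun p => ¬ b p ≤ s j) with hQ
    have hsum : ∑ p ∈ Q, b p ≤ j * s j ^ 2 := by
      have h1 : ∑ p ∈ Q, b p ≤ ∑ p ∈ Finset.range (2 * j + 1), b p := by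
        refine Finset.sum_le_sum_of_subset_of_nonneg (fun p hp => ?_) fun p _ _ => hb p
        have := (Finset.mem_Icc.1 (Finset.mem_filter.1 hp).1).2
        exact Finset.mem_range.2 (by omega)
      have h2 : ∑ p ∈ Finset.range (2 * j + 1), b p = (2 * j + 1) * a (2 * j + 1) := by
        simp only [ha]
        push_cast
        field_simp
      have h3 : s j ^ 2 = 3 * a (2 * j + 1) := Real.sq_sqrt (by linarith [ha0 (2 * j + 1)])
      rw [h3]
      nlinarith [ha0 (2 * j + 1)]
    have hlow : (Q.card : ℝ) * s j ≤ ∑ p ∈ Q, b p := by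
      rw [← nsmul_eq_mul]
      exact Finset.card_nsmul_le_sum _ _ _ fun p hp =>
        (not_le.1 (Finset.mem_filter.1 hp).2).le
    rcases (hsn j).eq_or_lt with h0 | hpos
    · rw [← h0] at hsum ⊢
      have hQe : Q = ∅ := by
        by_contra hne
        have hpos : 0 < ∑ p ∈ Q, b p :=
          Finset.sum_pos (fun p hp => (hsn j).trans_lt (not_le.1 (Finset.mem_filter.1 hp).2))
            (Finset.nonempty_iff_ne_empty.2 hne)
        simp only [ne_eq, OfNat.ofNat_ne_zero, not_false_eq_true, zero_pow, mul_zero] at hsum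
        linarith
      simp [hQe]
    · have : (Q.card : ℝ) * s j ≤ (j * s j) * s j := by nlinarith
      exact le_of_mul_le_mul_right this hpos
  have hinv : Tendsto (fun j : ℕ => ((j : ℝ))⁻¹) atTop (𝓝 0) := tendsto_inv_atTop_nhds_zero_nat
  have hlo : Tendsto (fun j : ℕ => 1 + (j : ℝ)⁻¹ - s j) atTop (𝓝 1) := by
    simpa using (hinv.const_add 1).sub hs0
  have hhi : Tendsto (fun j : ℕ => 1 + (j : ℝ)⁻¹) atTop (𝓝 1) := by
    simpa using hinv.const_add 1
  refine tendsto_of_tendsto_of_tendsto_of_le_of_le' hlo hhi ?_ ?_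
  · filter_upwards [eventually_ge_atTop 1] with j hj
    have hj' : (0 : ℝ) < j := by exact_mod_cast hj
    have h1 := Finset.card_filter_add_card_filter_not (s := Finset.Icc j (2 * j))
      (fun p => b p ≤ s j)
    rw [hcard] at h1
    have h2 : (((Finset.Icc j (2 * j)).filter (fun p => b p ≤ s j)).card : ℝ) +
        (((Finset.Icc j (2 * j)).filter (fun p => ¬ b p ≤ s j)).card : ℝ) = j + 1 := by
      exact_mod_cast h1
    rw [le_div_iff₀ hj']
    have h3 : (1 + (j : ℝ)⁻¹ - s j) * j = j + 1 - j * s j := by field_simp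
    rw [h3]
    linarith [hbad j hj]
  · filter_upwards [eventually_ge_atTop 1] with j hj
    have hj' : (0 : ℝ) < j := by exact_mod_cast hj
    have h1 := Finset.card_filter_le (Finset.Icc j (2 * j)) (fun p => b p ≤ s j)
    rw [hcard] at h1
    rw [div_le_iff₀ hj']
    have h3 : (1 + (j : ℝ)⁻¹) * j = j + 1 := by field_simp
    rw [h3]
    exact_mod_cast h1

theorem abs_measureReal_sub_le_symmDiff {Y : Type*} [MeasurableSpace Y] {ν : Measure Y}
    [IsFiniteMeasure ν] (A B : Set Y) : |ν.real A - ν.real B| ≤ ν.real (A ∆ B) := by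
  have h : ∀ A B : Set Y, ν.real A ≤ ν.real B + ν.real (A ∆ B) := fun A B => by
    refine (measureReal_mono (s₂ := B ∪ A ∆ B) fun x hx => ?_).trans (measureReal_union_le _ _)
    by_cases hB : x ∈ B
    · exact .inl hB
    · exact .inr (.inl ⟨hx, hB⟩)
  rw [abs_le]
  have h1 := h A B
  have h2 := h B A
  rw [symmDiff_comm] at h2
  constructor <;> linarith

/-- A single weighted sum `b` of the squared correlation defects of all `F k` has Cesàro means
tending to zero. Its windows therefore serve every `F k`, and by approximation every `D`. -/
theorem exists_windows_measure_inter_pos {X : Type*} [MeasurableSpace X] {μ : Measure X}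
    [IsProbabilityMeasure μ] {T : X → X} (hT : Ergodic T μ)
    (hTT : Ergodic (Prod.map T T) (μ.prod μ)) {F : ℕ → Set X}
    (hF : μ.MeasureDense (Set.range F)) :
    ∃ P : ℕ → Finset ℕ, (∀ j, P j ⊆ Finset.Icc j (2 * j)) ∧
      Tendsto (fun j : ℕ => ((P j).card : ℝ) / (j : ℝ)) atTop (𝓝 1) ∧
      ∀ D : Set X, MeasurableSet D → 0 < μ D →
        ∀ᶠ j in atTop, ∀ p ∈ P j, 0 < μ.real (D ∩ T^[p] ⁻¹' D) := by
  have hFm : ∀ k, MeasurableSet (F k) := fun k => hF.measurable _ ⟨k, rfl⟩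
  set a : ℕ → ℕ → ℝ := fun k p => (μ.real (F k ∩ T^[p] ⁻¹' F k) - μ.real (F k) ^ 2) ^ 2 with ha
  have ha0 : ∀ k p, 0 ≤ a k p := fun k p => sq_nonneg _
  have ha1 : ∀ k p, a k p ≤ 1 := fun k p => by
    have h1 : μ.real (F k ∩ T^[p] ⁻¹' F k) ≤ 1 := measureReal_le_one
    have h2 : μ.real (F k) ≤ 1 := measureReal_le_one
    have h3 : 0 ≤ μ.real (F k ∩ T^[p] ⁻¹' F k) := measureReal_nonneg
    have h4 : 0 ≤ μ.real (F k) := measureReal_nonneg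
    simp only [ha]
    rw [sq_le_one_iff_abs_le_one, abs_le]
    constructor <;> nlinarith
  have hsumm : ∀ p, Summable fun k => (1 / 2 : ℝ) ^ k * a k p := fun p =>
    Summable.of_nonneg_of_le (fun k => mul_nonneg (by positivity) (ha0 k p))
      (fun k => mul_le_of_le_one_right (by positivity) (ha1 k p)) summable_geometric_two
  set b : ℕ → ℝ := fun p => ∑' k, (1 / 2 : ℝ) ^ k * a k p with hb
  have hb0 : ∀ p, 0 ≤ b p := fun p =>
    tsum_nonneg fun k => mul_nonneg (by positivity) (ha0 k p)
  have hlim : Tendsto (fun n : ℕ => (n : ℝ)⁻¹ * ∑ p ∈ Finset.range n, b p) atTop (𝓝 0) := by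
    have h1 : ∀ n : ℕ, (n : ℝ)⁻¹ * ∑ p ∈ Finset.range n, b p =
        ∑' k, (1 / 2 : ℝ) ^ k * ((n : ℝ)⁻¹ * ∑ p ∈ Finset.range n, a k p) := by
      intro n
      rw [hb, ← Summable.tsum_finsetSum fun p _ => hsumm p, ← tsum_mul_left]
      refine tsum_congr fun k => ?_
      rw [← Finset.mul_sum]
      ring
    simp only [h1]
    have h2 := tendsto_tsum_of_dominated_convergence (𝓕 := atTop)
      (f := fun (n : ℕ) (k : ℕ) => (1 / 2 : ℝ) ^ k * ((n : ℝ)⁻¹ * ∑ p ∈ Finset.range n, a k p))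
      (g := fun _ => 0) summable_geometric_two
      (fun k => by
        simpa using (tendsto_average_sq_of_ergodic_prod hT hTT (hFm k)).const_mul ((1 / 2 : ℝ) ^ k))
      (.of_forall fun n k => by
        have h0 : 0 ≤ ∑ p ∈ Finset.range n, a k p := Finset.sum_nonneg fun p _ => ha0 k p
        have h3 : ∑ p ∈ Finset.range n, a k p ≤ n := by
          simpa using Finset.sum_le_card_nsmul (Finset.range n) (a k) 1 fun p _ => ha1 k p
        have h4 : (n : ℝ)⁻¹ * ∑ p ∈ Finset.range n, a k p ≤ 1 := by
          rw [inv_mul_eq_div]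
          exact div_le_one_of_le₀ h3 (by positivity)
        rw [Real.norm_of_nonneg (by positivity)]
        exact mul_le_of_le_one_right (by positivity) h4)
    simpa using h2
  obtain ⟨P, s, hP1, hP2, hs, hPs⟩ := exists_windows_of_average_tendsto_zero hb0 hlim
  refine ⟨P, hP1, hP2, fun D hD hD0 => ?_⟩
  have hd : 0 < μ.real D := by
    rw [measureReal_def]; exact ENNReal.toReal_pos hD0.ne' (measure_ne_top _ _)
  set d := μ.real D with hdd
  -- Since `d ≤ 1`, `μ(F k) ≥ 7d/8`; the correlation loses at most `3d²/8` altogether, which is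
  -- below `(7d/8)²`.
  obtain ⟨_, ⟨k, rfl⟩, hk⟩ := hF.approx D hD (measure_ne_top _ _) (d ^ 2 / 8) (by positivity)
  have hk' : μ.real (D ∆ F k) < d ^ 2 / 8 := by
    rw [measureReal_def]
    exact ENNReal.toReal_lt_of_lt_ofReal hk
  have hev : ∀ᶠ j in atTop, 2 ^ k * s j < (d ^ 2 / 8) ^ 2 := by
    have h1 : Tendsto (fun j => 2 ^ k * s j) atTop (𝓝 0) := by simpa using hs.const_mul (2 ^ k)
    exact h1.eventually_lt_const (by positivity)
  filter_upwards [hev] with j hj p hp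
  have h1 : a k p ≤ 2 ^ k * s j := by
    have h2 : (1 / 2 : ℝ) ^ k * a k p ≤ b p :=
      (hsumm p).le_tsum k fun i _ => mul_nonneg (by positivity) (ha0 i p)
    have h3 := h2.trans (hPs j p hp)
    have h4 : a k p = 2 ^ k * ((1 / 2 : ℝ) ^ k * a k p) := by
      rw [← mul_assoc, ← mul_pow]; norm_num
    rw [h4]
    gcongr
  have h2 : |μ.real (F k ∩ T^[p] ⁻¹' F k) - μ.real (F k) ^ 2| < d ^ 2 / 8 :=
    abs_lt_of_sq_lt_sq (h1.trans_lt hj) (by positivity)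
  have h3 : |μ.real (D ∩ T^[p] ⁻¹' D) - μ.real (F k ∩ T^[p] ⁻¹' F k)| ≤ 2 * (d ^ 2 / 8) := by
    refine (abs_measureReal_sub_le_symmDiff _ _).trans ?_
    have hsub : (D ∩ T^[p] ⁻¹' D) ∆ (F k ∩ T^[p] ⁻¹' F k) ⊆ D ∆ F k ∪ T^[p] ⁻¹' (D ∆ F k) := by
      intro x hx
      simp only [Set.mem_symmDiff, Set.mem_inter_iff, Set.mem_preimage, Set.mem_union] at hx ⊢
      tauto
    have h4 : μ.real (T^[p] ⁻¹' (D ∆ F k)) = μ.real (D ∆ F k) :=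
      (hT.toMeasurePreserving.iterate p).measureReal_preimage
        (hD.symmDiff (hFm k)).nullMeasurableSet
    have := (measureReal_mono hsub).trans (measureReal_union_le (μ := μ) _ _)
    linarith
  have h5 : |d - μ.real (F k)| ≤ d ^ 2 / 8 := (abs_measureReal_sub_le_symmDiff _ _).trans hk'.le
  have hd1 : d ≤ 1 := measureReal_le_one
  have hf1 : μ.real (F k) ≤ 1 := measureReal_le_one
  have hf0 : 0 ≤ μ.real (F k) := measureReal_nonneg
  rw [abs_lt] at h2
  rw [abs_le] at h3 h5
  nlinarith

/-! ### Estimates for the Halmos metric -/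

namespace Automorphism

variable {Y : Type*} [MeasurableSpace Y] {ν : Measure Y}

theorem measurableSet_preimage (T : Automorphism ν) {A : Set Y} (hA : MeasurableSet A) :
    MeasurableSet (T ⁻¹' A) := T.preserves.measurable hA

theorem measureReal_preimage (T : Automorphism ν) (A : Set Y) :
    ν.real (T ⁻¹' A) = ν.real A := by
  rw [measureReal_def, measureReal_def,
    T.preserves.measure_preimage_emb T.toMeasurableEquiv.measurableEmbedding]

theorem invFun'_image (T : Automorphism ν) (A : Set Y) : T.invFun' '' A = T ⁻¹' A :=
  Equiv.image_symm_eq_preimage T.toEquiv A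

theorem measureReal_image_symmDiff_self (T : Automorphism ν) (A : Set Y) :
    ν.real ((T '' A) ∆ A) = ν.real ((T ⁻¹' A) ∆ A) := by
  rw [← T.measureReal_preimage, Set.preimage_symmDiff,
    Set.preimage_image_eq _ T.toEquiv.injective, symmDiff_comm]

end Automorphism

section Halmos

variable {Y : Type*} [MeasurableSpace Y] {ν : Measure Y}

theorem halmosDist_nonneg (B : ℕ → Set Y) (T T₀ : Automorphism ν) : 0 ≤ halmosDist B T T₀ :=
  tsum_nonneg fun i => by positivity

/-- `T` moves each of the first `m` sets of the sequence `F` by less than `1 / (m + 1)`. -/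
def AlmostFixes (F : ℕ → Set Y) (m : ℕ) (T : Automorphism ν) : Prop :=
  ∀ i < m, ν.real ((T ⁻¹' F i) ∆ F i) < 1 / ((m : ℝ) + 1)

theorem AlmostFixes.mono {F : ℕ → Set Y} {m n : ℕ} (hmn : m ≤ n) {T : Automorphism ν}
    (h : AlmostFixes F n T) : AlmostFixes F m T := fun i hi =>
  (h i (hi.trans_le hmn)).trans_le <| by gcongr

variable [IsProbabilityMeasure ν]

theorem measureReal_preimage_symmDiff_le_halmosDist (B : ℕ → Set Y) (T T₀ : Automorphism ν)
    (i : ℕ) : ν.real ((T ⁻¹' B i) ∆ (T₀ ⁻¹' B i)) ≤ 2 ^ i * halmosDist B T T₀ := by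
  have h1 : (1 / 2 : ℝ) ^ i * (ν.real ((T '' B i) ∆ (T₀ '' B i)) +
      ν.real ((T.invFun' '' B i) ∆ (T₀.invFun' '' B i))) ≤ halmosDist B T T₀ :=
    (summable_halmosDist B T T₀).le_tsum i fun k _ => by positivity
  rw [T.invFun'_image, T₀.invFun'_image] at h1
  have h2 : 0 ≤ ν.real ((T '' B i) ∆ (T₀ '' B i)) := measureReal_nonneg
  calc ν.real ((T ⁻¹' B i) ∆ (T₀ ⁻¹' B i))
      = 2 ^ i * ((1 / 2 : ℝ) ^ i * ν.real ((T ⁻¹' B i) ∆ (T₀ ⁻¹' B i))) := by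
        rw [← mul_assoc, ← mul_pow]; norm_num
    _ ≤ 2 ^ i * halmosDist B T T₀ := by
        gcongr
        refine le_trans ?_ h1
        gcongr
        linarith

theorem halmosDist_le_of_forall {B : ℕ → Set Y} {T T₀ : Automorphism ν} {c : ℝ}
    (h1 : ∀ i, ν.real ((T '' B i) ∆ (T₀ '' B i)) ≤ c)
    (h2 : ∀ i, ν.real ((T ⁻¹' B i) ∆ (T₀ ⁻¹' B i)) ≤ c) : halmosDist B T T₀ ≤ 4 * c := by
  have h3 : ∑' i : ℕ, (1 / 2 : ℝ) ^ i * (2 * c) = 4 * c := by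
    rw [tsum_mul_right, tsum_geometric_two]; ring
  rw [← h3]
  refine (summable_halmosDist B T T₀).tsum_le_tsum (fun i => ?_)
    (summable_geometric_two.mul_right _)
  rw [T.invFun'_image, T₀.invFun'_image]
  gcongr
  linarith [h1 i, h2 i]

theorem tendsto_preimage_of_halmosDist {ι : Type*} {l : Filter ι} {B : ℕ → Set Y}
    (hB : ν.MeasureDense (Set.range B)) {T : ι → Automorphism ν} {T₀ : Automorphism ν}
    (h : Tendsto (fun k => halmosDist B (T k) T₀) l (𝓝 0)) {G : Set Y} (hG : MeasurableSet G) :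
    Tendsto (fun k => ν.real ((T k ⁻¹' G) ∆ (T₀ ⁻¹' G))) l (𝓝 0) := by
  refine tendsto_order.2 ⟨fun a ha => .of_forall fun k => ha.trans_le measureReal_nonneg,
    fun ε hε => ?_⟩
  obtain ⟨_, ⟨i, rfl⟩, hi⟩ := hB.approx G hG (measure_ne_top _ _) (ε / 4) (by positivity)
  have hi' : ν.real (G ∆ B i) < ε / 4 := ENNReal.toReal_lt_of_lt_ofReal hi
  have h1 : Tendsto (fun k => 2 ^ i * halmosDist B (T k) T₀) l (𝓝 0) := by
    simpa using h.const_mul (2 ^ i)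
  filter_upwards [h1.eventually_lt_const (show (0 : ℝ) < ε / 4 by positivity)] with k hk
  have hsub : (T k ⁻¹' G) ∆ (T₀ ⁻¹' G) ⊆
      (T k ⁻¹' (G ∆ B i) ∪ T₀ ⁻¹' (G ∆ B i)) ∪ (T k ⁻¹' B i) ∆ (T₀ ⁻¹' B i) := by
    intro x
    simp only [Set.mem_symmDiff, Set.mem_preimage, Set.mem_union]
    tauto
  have h2 := (measureReal_mono (μ := ν) hsub).trans ((measureReal_union_le _ _).trans
    (add_le_add_left (measureReal_union_le _ _) _))
  rw [(T k).measureReal_preimage, T₀.measureReal_preimage] at h2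
  linarith [measureReal_preimage_symmDiff_le_halmosDist B (T k) T₀ i]

/-- Induction on `p`: change the last `p` factors first, using that `T k` preserves measure, then
the remaining one, applied to the fixed set `T₀⁻ᵖ G`. -/
theorem tendsto_iterate_preimage_of_halmosDist {ι : Type*} {l : Filter ι} {B : ℕ → Set Y}
    (hB : ν.MeasureDense (Set.range B)) {T : ι → Automorphism ν} {T₀ : Automorphism ν}
    (h : Tendsto (fun k => halmosDist B (T k) T₀) l (𝓝 0)) {G : Set Y} (hG : MeasurableSet G)
    (p : ℕ) :
    Tendsto (fun k => ν.real (((T k)^[p] ⁻¹' G) ∆ (T₀^[p] ⁻¹' G))) l (𝓝 0) := by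
  induction p with
  | zero => simpa using tendsto_const_nhds
  | succ p ih =>
    have h1 := ih.add (tendsto_preimage_of_halmosDist hB h
      ((T₀.preserves.iterate p).measurable hG))
    rw [add_zero] at h1
    refine squeeze_zero (fun k => measureReal_nonneg) (fun k => ?_) h1
    rw [← (T k).measureReal_preimage (((T k)^[p] ⁻¹' G) ∆ (T₀^[p] ⁻¹' G))]
    refine (measureReal_mono fun x => ?_).trans (measureReal_union_le _ _)
    simp only [Set.mem_symmDiff, Set.mem_preimage, Set.mem_union, Function.iterate_succ_apply]
    tauto

/-- Images and preimages of a set are moved equally far from it, so preimages suffice. The first `m`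
terms contribute at most `4/(m+1)`, the geometric tail at most `4·2⁻ᵐ`. -/
theorem exists_almostFixes_imp_halmosDist_lt (F : ℕ → Set Y) {ε : ℝ} (hε : 0 < ε) :
    ∃ m : ℕ, ∀ T : Automorphism ν, AlmostFixes F m T →
      halmosDist F T (Automorphism.one ν) < ε := by
  have h1 : Tendsto (fun m : ℕ => 4 * (1 / ((m : ℝ) + 1)) + 4 * (1 / 2 : ℝ) ^ m) atTop (𝓝 0) := by
    have h2 := (tendsto_one_div_add_atTop_nhds_zero_nat (𝕜 := ℝ)).const_mul 4
    have h3 := (tendsto_pow_atTop_nhds_zero_of_lt_one (r := (1 / 2 : ℝ)) (by norm_num)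
      (by norm_num)).const_mul 4
    simpa using h2.add h3
  obtain ⟨m, hm⟩ := (h1.eventually_lt_const hε).exists
  refine ⟨m, fun T hT => lt_of_le_of_lt ?_ hm⟩
  have hs := summable_halmosDist F T (Automorphism.one ν)
  have hterm : ∀ i, (1 / 2 : ℝ) ^ i * (ν.real ((T '' F i) ∆ ((Automorphism.one ν) '' F i)) +
      ν.real ((T.invFun' '' F i) ∆ ((Automorphism.one ν).invFun' '' F i))) =
      (1 / 2 : ℝ) ^ i * (2 * ν.real ((T ⁻¹' F i) ∆ F i)) := by
    intro i
    have e1 : (Automorphism.one ν) '' F i = F i := Set.image_id _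
    have e2 : (Automorphism.one ν).invFun' '' F i = F i := Set.image_id _
    rw [e1, e2, T.invFun'_image, T.measureReal_image_symmDiff_self]
    ring
  unfold halmosDist
  rw [← hs.sum_add_tsum_nat_add m]
  have hle : ∀ i, ν.real ((T ⁻¹' F i) ∆ F i) ≤ 1 := fun i => measureReal_le_one
  refine add_le_add ?_ ?_
  · calc _ ≤ ∑ i ∈ Finset.range m, (1 / 2 : ℝ) ^ i * (2 * (1 / ((m : ℝ) + 1))) := by
          refine Finset.sum_le_sum fun i hi => ?_
          rw [hterm]
          gcongr
          exact (hT i (Finset.mem_range.1 hi)).le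
      _ ≤ ∑' i : ℕ, (1 / 2 : ℝ) ^ i * (2 * (1 / ((m : ℝ) + 1))) :=
          (summable_geometric_two.mul_right _).sum_le_tsum _ fun i _ => by positivity
      _ = _ := by rw [tsum_mul_right, tsum_geometric_two]; ring
  · calc _ ≤ ∑' i : ℕ, (1 / 2 : ℝ) ^ i * (2 * (1 / 2 : ℝ) ^ m) := by
          refine ((summable_nat_add_iff m).2 hs).tsum_le_tsum (fun i => ?_)
            (summable_geometric_two.mul_right _)
          rw [hterm, pow_add]
          have := hle (i + m)
          calc _ ≤ (1 / 2 : ℝ) ^ i * (1 / 2 : ℝ) ^ m * (2 * 1) := by gcongr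
            _ = _ := by ring
      _ = _ := by rw [tsum_mul_right, tsum_geometric_two]; ring

end Halmos

/-! ### Dependence of the cocycle on the extension -/

namespace Extension

variable {X : Type*} [MeasurableSpace X] [StandardBorelSpace X] {μ : Measure X}
  [IsProbabilityMeasure μ] {S : Automorphism μ}

theorem iterate_toAutomorphism (R : Extension S) (p : ℕ) (x y : X) :
    R.toAutomorphism^[p] (x, y) = (S^[p] x, R.cocycle x p y) := by
  induction p with
  | zero => rfl
  | succ p ih =>
    rw [Function.iterate_succ_apply', ih, Function.iterate_succ_apply']
    rfl

theorem measurable_cocycle (R : Extension S) (p : ℕ) :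
    Measurable fun q : X × X => R.cocycle q.1 p q.2 := by
  have h : Measurable fun q : X × X => (R.toAutomorphism^[p] q).2 :=
    measurable_snd.comp (R.toAutomorphism.preserves.iterate p).measurable
  have he : (fun q : X × X => (R.toAutomorphism^[p] q).2) = fun q => R.cocycle q.1 p q.2 := by
    ext ⟨x, y⟩
    rw [iterate_toAutomorphism]
  rwa [he] at h

theorem measurableSet_almostFixes (R : Extension S) {F : ℕ → Set X}
    (hF : ∀ i, MeasurableSet (F i)) (m p : ℕ) :
    MeasurableSet {x | AlmostFixes F m (R.cocycle x p)} := by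
  have h : {x | AlmostFixes F m (R.cocycle x p)} =
      ⋂ i, ⋂ (_ : i < m), {x | μ.real ((R.cocycle x p ⁻¹' F i) ∆ F i) < 1 / ((m : ℝ) + 1)} := by
    ext x; simp [AlmostFixes]
  rw [h]
  refine MeasurableSet.iInter fun i => MeasurableSet.iInter fun _ => ?_
  refine measurableSet_lt ?_ measurable_const
  exact (measurable_measure_prodMk_left (ν := μ)
    (((R.measurable_cocycle p) (hF i)).symmDiff (measurable_snd (hF i)))).ennreal_toReal

/-- Apply convergence of iterates to the cylinder `X × G`: its fibrewise symmetric differences are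
those of the cocycles, and Fubini with Markov's inequality yields convergence in measure. -/
theorem tendsto_measureReal_cocycle {ι : Type*} {l : Filter ι} {B : ℕ → Set (X × X)}
    (hB : (μ.prod μ).MeasureDense (Set.range B)) {R : ι → Extension S} {R₀ : Extension S}
    (h : Tendsto (fun k => halmosDist B (R k).toAutomorphism R₀.toAutomorphism) l (𝓝 0))
    {G : Set X} (hG : MeasurableSet G) (p : ℕ) {δ : ℝ} (hδ : 0 < δ) :
    Tendsto (fun k => μ.real {x | δ ≤ μ.real (((R k).cocycle x p ⁻¹' G) ∆
      (R₀.cocycle x p ⁻¹' G))}) l (𝓝 0) := by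
  have h1 := (tendsto_iterate_preimage_of_halmosDist hB h (measurable_snd hG) p).const_mul δ⁻¹
  rw [mul_zero] at h1
  refine squeeze_zero (fun k => measureReal_nonneg) (fun k => ?_) h1
  set Z := ((R k).toAutomorphism^[p] ⁻¹' (Prod.snd ⁻¹' G)) ∆
    (R₀.toAutomorphism^[p] ⁻¹' (Prod.snd ⁻¹' G)) with hZ
  have hZm : MeasurableSet Z :=
    (((R k).toAutomorphism.preserves.iterate p).measurable (measurable_snd hG)).symmDiff
      ((R₀.toAutomorphism.preserves.iterate p).measurable (measurable_snd hG))
  have hfib : ∀ x, Prod.mk x ⁻¹' Z =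
      ((R k).cocycle x p ⁻¹' G) ∆ (R₀.cocycle x p ⁻¹' G) := by
    intro x
    ext y
    simp only [hZ, Set.mem_preimage, Set.mem_symmDiff, iterate_toAutomorphism]
  have h2 := meas_ge_le_lintegral_div (μ := μ) (f := fun x => μ (Prod.mk x ⁻¹' Z))
    (measurable_measure_prodMk_left hZm).aemeasurable (ε := ENNReal.ofReal δ)
    (by simpa using hδ) ENNReal.ofReal_ne_top
  rw [← Measure.prod_apply hZm] at h2
  have h3 : {x | ENNReal.ofReal δ ≤ μ (Prod.mk x ⁻¹' Z)} =
      {x | δ ≤ μ.real (((R k).cocycle x p ⁻¹' G) ∆ (R₀.cocycle x p ⁻¹' G))} := by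
    ext x
    simp only [Set.mem_ofPred_eq, hfib]
    rw [measureReal_def, ENNReal.ofReal_le_iff_le_toReal (measure_ne_top _ _)]
  rw [h3] at h2
  have h4 := ENNReal.toReal_mono (by
    exact ENNReal.div_ne_top (measure_ne_top _ _) (by simpa using hδ)) h2
  rw [ENNReal.toReal_div, ENNReal.toReal_ofReal hδ.le] at h4
  rw [inv_mul_eq_div]
  exact h4

/-- If `R k → R₀`, then off sets of small measure the cocycle of `R k` almost fixes the
first `m` sets wherever the cocycle of `R₀` does so with a margin. -/
theorem tendsto_measureReal_not_almostFixes {ι : Type*} {l : Filter ι} {B : ℕ → Set (X × X)}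
    (hB : (μ.prod μ).MeasureDense (Set.range B)) {R : ι → Extension S} {R₀ : Extension S}
    (h : Tendsto (fun k => halmosDist B (R k).toAutomorphism R₀.toAutomorphism) l (𝓝 0))
    {F : ℕ → Set X} (hF : ∀ i, MeasurableSet (F i)) (m p : ℕ) :
    Tendsto (fun k => μ.real {x | AlmostFixes F (2 * m + 1) (R₀.cocycle x p) ∧
      ¬ AlmostFixes F m ((R k).cocycle x p)}) l (𝓝 0) := by
  -- Half of the tolerance `1/(m+1)`; the index `2m+1` is chosen so that its own tolerance is
  -- exactly `δ`.
  set δ : ℝ := 1 / (2 * ((m : ℝ) + 1)) with hδ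
  have hδ0 : 0 < δ := by positivity
  have h1 : Tendsto (fun k => ∑ i ∈ Finset.range m, μ.real {x | δ ≤ μ.real
      (((R k).cocycle x p ⁻¹' F i) ∆ (R₀.cocycle x p ⁻¹' F i))}) l (𝓝 0) := by
    simpa using tendsto_finsetSum (Finset.range m)
      fun i _ => tendsto_measureReal_cocycle hB h (hF i) p hδ0
  refine squeeze_zero (fun k => measureReal_nonneg) (fun k => ?_) h1
  refine (measureReal_mono (fun x hx => ?_) (measure_ne_top _ _)).trans
    (measureReal_biUnion_finset_le _ _)
  obtain ⟨hx0, hx⟩ := hx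
  simp only [AlmostFixes, not_forall, not_lt] at hx
  obtain ⟨i, him, hi⟩ := hx
  have h2 := hx0 i (by omega)
  simp only [Set.mem_iUnion, Finset.mem_range, Set.mem_ofPred_eq]
  refine ⟨i, him, ?_⟩
  have h3 : μ.real (((R k).cocycle x p ⁻¹' F i) ∆ F i) ≤
      μ.real (((R k).cocycle x p ⁻¹' F i) ∆ (R₀.cocycle x p ⁻¹' F i)) +
      μ.real ((R₀.cocycle x p ⁻¹' F i) ∆ F i) :=
    (measureReal_mono (symmDiff_triangle _ _ _)).trans (measureReal_union_le _ _)
  have h4 : (1 : ℝ) / (((2 * m + 1 : ℕ) : ℝ) + 1) = δ := by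
    rw [hδ]; push_cast; congr 1; ring
  have h5 : 1 / ((m : ℝ) + 1) = δ + δ := by rw [hδ]; field_simp; norm_num
  rw [h4] at h2
  linarith

end Extension

/-! ### Density of return-trivial extensions -/

namespace Automorphism

variable {X : Type*} [MeasurableSpace X] {μ : Measure X}

/-- The inverse automorphism. -/
def inv (T : Automorphism μ) : Automorphism μ where
  toMeasurableEquiv := T.toMeasurableEquiv.symm
  preserves := T.preserves.symm T.toMeasurableEquiv

theorem apply_inv (T : Automorphism μ) (x : X) : T (T.inv x) = x :=
  T.toEquiv.apply_symm_apply x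

theorem inv_apply (T : Automorphism μ) (x : X) : T.inv (T x) = x :=
  T.toEquiv.symm_apply_apply x

theorem iterate_image (T : Automorphism μ) (n : ℕ) (B : Set X) :
    T^[n] '' B = T.inv^[n] ⁻¹' B :=
  congrFun (Set.image_eq_preimage_of_inverse (Function.LeftInverse.iterate T.inv_apply n)
    (Function.LeftInverse.iterate T.apply_inv n)) B

theorem IsWeaklyMixing.exists_tendsto [IsProbabilityMeasure μ] {S : Automorphism μ}
    (hS : S.IsWeaklyMixing) :
    ∃ j : ℕ → ℕ, ∀ A B : Set X, MeasurableSet A → MeasurableSet B →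
      Tendsto (fun k => μ.real (A ∩ S^[j k] ⁻¹' B)) atTop (𝓝 (μ.real A * μ.real B)) := by
  obtain ⟨j, -, h⟩ := hS
  refine ⟨j, fun A B hA hB => ?_⟩
  have h1 := (ENNReal.tendsto_toReal (ENNReal.mul_ne_top (measure_ne_top μ B)
    (measure_ne_top μ A))).comp (h B A hB hA)
  rw [ENNReal.toReal_mul, mul_comm] at h1
  refine h1.congr fun k => ?_
  have h2 : MeasurableSet (B ∩ S^[j k] '' A) := by
    rw [S.iterate_image]
    exact hB.inter ((S.inv.preserves.iterate _).measurable hA)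
  change μ.real _ = μ.real _
  rw [← (S.preserves.iterate (j k)).measureReal_preimage h2.nullMeasurableSet,
    Set.preimage_inter, Set.preimage_image_eq _ (S.toEquiv.injective.iterate _), Set.inter_comm]

end Automorphism

/-- Under mixing along a sequence, either the measure is trivial or there are sets of arbitrarily
small positive measure. -/
theorem measureReal_trivial_or_exists_small {X : Type*} [MeasurableSpace X] {μ : Measure X}
    [IsProbabilityMeasure μ] {T : X → X} (hT : Measurable T) {j : ℕ → ℕ}
    (h : ∀ A B : Set X, MeasurableSet A → MeasurableSet B →
      Tendsto (fun k => μ.real (A ∩ T^[j k] ⁻¹' B)) atTop (𝓝 (μ.real A * μ.real B))) :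
    (∀ A, MeasurableSet A → μ.real A = 0 ∨ μ.real A = 1) ∨
      ∀ ε > 0, ∃ E, MeasurableSet E ∧ 0 < μ.real E ∧ μ.real E < ε := by
  refine or_iff_not_imp_left.2 fun hne ε hε => ?_
  push Not at hne
  obtain ⟨A, hA, hA0, hA1⟩ := hne
  set a := μ.real A with ha
  have ha0 : 0 < a := lt_of_le_of_ne measureReal_nonneg (Ne.symm hA0)
  have ha1 : a < 1 := lt_of_le_of_ne measureReal_le_one hA1
  -- Replacing `E` by `E ∩ T⁻ʲE` along the mixing sequence gives measure near `μ(E)² ≤ a μ(E)`, so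
  -- it shrinks geometrically yet stays positive.
  have key : ∀ n : ℕ, ∃ E, MeasurableSet E ∧ 0 < μ.real E ∧ μ.real E ≤ a ∧
      μ.real E ≤ ((1 + a) / 2) ^ n := by
    intro n
    induction n with
    | zero => exact ⟨A, hA, ha0, le_rfl, by simp [← ha, ha1.le]⟩
    | succ n ih =>
      obtain ⟨E, hE, hE0, hEa, hEn⟩ := ih
      have h1 := h E E hE hE
      have h2 : μ.real E * μ.real E < μ.real E * ((1 + a) / 2) := by
        apply mul_lt_mul_of_pos_left _ hE0
        linarith
      obtain ⟨k, hk1, hk2⟩ := ((h1.eventually_const_lt (mul_pos hE0 hE0)).and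
        (h1.eventually_lt_const h2)).exists
      refine ⟨_, hE.inter (hT.iterate (j k) hE), hk1,
        (measureReal_mono Set.inter_subset_left).trans hEa, hk2.le.trans ?_⟩
      rw [pow_succ]
      gcongr
  obtain ⟨n, hn⟩ := exists_pow_lt_of_lt_one hε (show (1 + a) / 2 < 1 by linarith)
  obtain ⟨E, hE, hE0, -, hEn⟩ := key n
  exact ⟨E, hE, hE0, hEn.trans_lt hn⟩

/-- By ergodicity almost every orbit meets `E`. Adjoining the null set of exceptions makes every
orbit do so, which a pointwise first-visit time needs. -/
theorem exists_sweeping_set {X : Type*} [MeasurableSpace X] {μ : Measure X}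
    [IsProbabilityMeasure μ] {V : X → X} (hV : Ergodic V μ) {E : Set X} (hE : MeasurableSet E)
    (hE0 : 0 < μ.real E) :
    ∃ E', MeasurableSet E' ∧ μ.real E' = μ.real E ∧ ∀ x, ∃ n, V^[n] x ∈ E' := by
  set U : Set X := ⋃ n : ℕ, V^[n] ⁻¹' E with hU
  have hUm : MeasurableSet U := MeasurableSet.iUnion fun n => hV.measurable.iterate n hE
  have hVU : V ⁻¹' U ⊆ U := by
    intro x hx
    obtain ⟨n, hn⟩ := Set.mem_iUnion.1 hx
    exact Set.mem_iUnion.2 ⟨n + 1, hn⟩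
  have hEU : E ⊆ U := fun x hx => Set.mem_iUnion.2 ⟨0, hx⟩
  have hUc : μ Uᶜ = 0 := by
    rcases hV.ae_empty_or_univ_of_preimage_ae_le hUm.nullMeasurableSet
      (LE.le.eventuallyLE hVU) with h | h
    · have h1 : μ.real E = 0 := by
        rw [measureReal_def, measure_mono_null hEU (ae_eq_empty.1 h)]; rfl
      exact absurd h1 hE0.ne'
    · exact ae_eq_univ.1 h
  refine ⟨E ∪ Uᶜ, hE.union hUm.compl, ?_, fun x => ?_⟩
  · rw [measureReal_def, measureReal_def,
      measure_congr (union_ae_eq_left_of_ae_eq_empty (ae_eq_empty.2 hUc))]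
  · by_cases hx : x ∈ U
    · obtain ⟨n, hn⟩ := Set.mem_iUnion.1 hx
      exact ⟨n, .inl hn⟩
    · exact ⟨0, .inr hx⟩

namespace Extension

variable {X : Type*} [MeasurableSpace X] {μ : Measure X} {S : Automorphism μ}

/-- For every precision there is a countable measurable cover of the base such that the cocycle
almost fixes the sets `F i` whenever an orbit returns to a piece of the cover. -/
def IsReturnTrivial (F : ℕ → Set X) (R : Extension S) : Prop :=
  ∀ m : ℕ, ∃ D : ℕ → Set X, (∀ l, MeasurableSet (D l)) ∧ ⋃ l, D l = Set.univ ∧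
    ∀ l x p, x ∈ D l → S^[p] x ∈ D l → AlmostFixes F m (R.cocycle x p)

theorem isReturnTrivial_of_trivial_measure [IsProbabilityMeasure μ] {F : ℕ → Set X} (hF : ∀ i, MeasurableSet (F i))
    (h : ∀ A, MeasurableSet A → μ.real A = 0 ∨ μ.real A = 1) (R : Extension S) :
    IsReturnTrivial F R := by
  intro m
  refine ⟨fun _ => Set.univ, fun _ => .univ, Set.iUnion_const _, fun l x p _ _ i hi => ?_⟩
  have h0 : ∀ T : Automorphism μ, ∀ A, μ.real A = 0 → μ.real ((T ⁻¹' A) ∆ A) = 0 := by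
    intro T A hA
    refine le_antisymm ?_ measureReal_nonneg
    refine (measureReal_mono (μ := μ) Set.symmDiff_subset_union).trans
      ((measureReal_union_le _ _).trans ?_)
    rw [T.measureReal_preimage, hA, add_zero]
  have h1 : μ.real ((R.cocycle x p ⁻¹' F i) ∆ F i) = 0 := by
    rcases h _ (hF i) with h2 | h2
    · exact h0 _ _ h2
    · rw [← compl_symmDiff_compl, ← Set.preimage_compl]
      refine h0 _ _ ?_
      rw [probReal_compl_eq_one_sub (hF i), h2, sub_self]
  rw [h1]
  positivity

variable [StandardBorelSpace X]

/-- The coboundary `x ↦ ψ (S x) ψ(x)⁻¹` of a measurable family `ψ` of automorphisms. -/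
def coboundary (S : Automorphism μ) (ψ : Extension (Automorphism.one μ)) : Extension S where
  fiber x := (ψ.fiber (S x)).comp (ψ.fiber x).inv
  measurable_fiber :=
    ψ.measurable_fiber.comp ((S.preserves.measurable.comp measurable_fst).prodMk
      (measurable_snd.comp ψ.measurable_toEquiv_symm))

theorem cocycle_coboundary (ψ : Extension (Automorphism.one μ)) (x : X) (p : ℕ) (y : X) :
    (coboundary S ψ).cocycle x p y = ψ.fiber (S^[p] x) ((ψ.fiber x).inv y) := by
  induction p with
  | zero => exact ((ψ.fiber x).apply_inv y).symm
  | succ p ih =>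
    change ψ.fiber (S (S^[p] x)) ((ψ.fiber (S^[p] x)).inv ((coboundary S ψ).cocycle x p y)) = _
    rw [ih, Automorphism.inv_apply, Function.iterate_succ_apply']

variable [IsProbabilityMeasure μ]

theorem isReturnTrivial_coboundary {F : ℕ → Set X} (hF : μ.MeasureDense (Set.range F))
    (ψ : Extension (Automorphism.one μ)) : IsReturnTrivial F (coboundary S ψ) := by
  have hFm : ∀ k, MeasurableSet (F k) := fun k => hF.measurable _ ⟨k, rfl⟩
  intro m
  set δ : ℝ := 1 / (2 * ((m : ℝ) + 1)) with hδ
  have hδ0 : 0 < δ := by positivity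
  obtain ⟨e, he⟩ := exists_surjective_nat (Fin m → ℕ)
  -- Pieces are coded by functions `Fin m → ℕ` recording which member of the dense sequence
  -- approximates each `ψ(x)⁻¹ F i`; two points with the same code differ by less than `2δ =
  -- 1/(m+1)`.
  refine ⟨fun l => ⋂ i : Fin m, {x | μ.real ((ψ.fiber x ⁻¹' F i) ∆ F (e l i)) < δ},
    fun l => MeasurableSet.iInter fun i => ?_, ?_, ?_⟩
  · exact measurableSet_lt (measurable_measure_prodMk_left (ν := μ)
      ((ψ.measurable_fiber (hFm i)).symmDiff (measurable_snd (hFm _)))).ennreal_toReal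
      measurable_const
  · refine Set.eq_univ_of_forall fun x => ?_
    have h1 : ∀ i : Fin m, ∃ k, μ.real ((ψ.fiber x ⁻¹' F i) ∆ F k) < δ := by
      intro i
      obtain ⟨_, ⟨k, rfl⟩, hk⟩ := hF.approx _
        ((ψ.fiber x).measurableSet_preimage (hFm i)) (measure_ne_top _ _) δ hδ0
      exact ⟨k, ENNReal.toReal_lt_of_lt_ofReal hk⟩
    choose k hk using h1
    obtain ⟨l, rfl⟩ := he k
    exact Set.mem_iUnion.2 ⟨l, Set.mem_iInter.2 hk⟩
  · intro l x p hx hpx i hi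
    have h1 := Set.mem_iInter.1 hx ⟨i, hi⟩
    have h2 := Set.mem_iInter.1 hpx ⟨i, hi⟩
    simp only [Set.mem_ofPred_eq] at h1 h2
    rw [symmDiff_comm] at h1
    have h3 : ψ.fiber x ⁻¹' (((coboundary S ψ).cocycle x p ⁻¹' F i) ∆ F i) =
        (ψ.fiber (S^[p] x) ⁻¹' F i) ∆ (ψ.fiber x ⁻¹' F i) := by
      ext y
      simp only [Set.mem_preimage, Set.mem_symmDiff, cocycle_coboundary, Automorphism.inv_apply]
    rw [← (ψ.fiber x).measureReal_preimage, h3]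
    have h4 := (measureReal_mono (μ := μ) (symmDiff_triangle (ψ.fiber (S^[p] x) ⁻¹' F i)
      (F (e l ⟨i, hi⟩)) (ψ.fiber x ⁻¹' F i))).trans (measureReal_union_le _ _)
    have h5 : 1 / ((m : ℝ) + 1) = δ + δ := by rw [hδ]; field_simp; norm_num
    rw [h5]
    linarith

theorem halmosDist_le_of_agree {B : ℕ → Set (X × X)} {R R' : Extension S} {N : Set X}
    (hN : MeasurableSet N) (h : ∀ x ∉ N, ∀ y, R.fiber x y = R'.fiber x y) :
    halmosDist B R.toAutomorphism R'.toAutomorphism ≤ 4 * μ.real N := by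
  have hagree : ∀ q : X × X, q.1 ∉ N → R.toAutomorphism q = R'.toAutomorphism q := fun q hq =>
    Prod.ext rfl (h q.1 hq q.2)
  refine halmosDist_le_of_forall (fun i => ?_) (fun i => ?_)
  · have hsub : (R.toAutomorphism '' B i) ∆ (R'.toAutomorphism '' B i) ⊆
        Prod.fst ⁻¹' (S.inv ⁻¹' N) := by
      rintro p (⟨⟨q, hq, rfl⟩, hp⟩ | ⟨⟨q, hq, rfl⟩, hp⟩)
      · change S.inv (S q.1) ∈ N
        rw [S.inv_apply]
        by_contra hqN
        exact hp ⟨q, hq, (hagree q hqN).symm⟩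
      · change S.inv (S q.1) ∈ N
        rw [S.inv_apply]
        by_contra hqN
        exact hp ⟨q, hq, hagree q hqN⟩
    refine (measureReal_mono hsub).trans_eq ?_
    rw [measurePreserving_fst.measureReal_preimage
      (S.inv.measurableSet_preimage hN).nullMeasurableSet, S.inv.measureReal_preimage]
  · have hsub : (R.toAutomorphism ⁻¹' B i) ∆ (R'.toAutomorphism ⁻¹' B i) ⊆ Prod.fst ⁻¹' N := by
      intro q hq
      by_contra hqN
      simp only [Set.mem_symmDiff, Set.mem_preimage, hagree q hqN] at hq
      tauto
    refine (measureReal_mono hsub).trans_eq ?_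
    rw [measurePreserving_fst.measureReal_preimage hN.nullMeasurableSet]

/-- Given a set `E` which every backward orbit visits, any extension agrees off `S⁻¹ E` with a
coboundary. -/
theorem exists_coboundary_agree (R : Extension S) {E : Set X} (hE : MeasurableSet E)
    (hvisit : ∀ x, ∃ n, S.inv^[n] x ∈ E) :
    ∃ ψ : Extension (Automorphism.one μ),
      ∀ x ∉ S ⁻¹' E, ∀ y, R.fiber x y = (coboundary S ψ).fiber x y := by
  classical
  have hVn : ∀ n, Measurable S.inv^[n] := fun n => (S.inv.preserves.iterate n).measurable
  -- `ψ x` is the cocycle accumulated since the latest visit to `E`, with value the identity on `E`.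
  -- Thus `ψ(Sx) = R_x ψ(x)` unless `Sx ∈ E`, where the count restarts. Extensions of the identity
  -- serve only to encode measurable families.
  let ψ : Extension (Automorphism.one μ) :=
    { fiber := fun x => R.cocycle (S.inv^[Nat.find (hvisit x)] x) (Nat.find (hvisit x))
      measurable_fiber :=
        Measurable.find (f := fun n (q : X × X) => R.cocycle (S.inv^[n] q.1) n q.2)
          (p := fun n (q : X × X) => S.inv^[n] q.1 ∈ E)
          (fun n => (R.measurable_cocycle n).comp
            (((hVn n).comp measurable_fst).prodMk measurable_snd))
          (fun n => ((hVn n).comp measurable_fst) hE) (fun q => hvisit q.1) }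
  refine ⟨ψ, fun x hx y => ?_⟩
  have hfind : Nat.find (hvisit (S x)) = Nat.find (hvisit x) + 1 := by
    rw [Nat.find_comp_succ (hvisit (S x)) ⟨Nat.find (hvisit x), ?_⟩ hx]
    · congr 1
      simp only [Function.iterate_succ_apply, Automorphism.inv_apply]
    · rw [Function.iterate_succ_apply, Automorphism.inv_apply]
      exact Nat.find_spec (hvisit x)
  have hψ : ψ.fiber (S x) = (R.fiber x).comp (ψ.fiber x) := by
    change R.cocycle (S.inv^[Nat.find (hvisit (S x))] (S x)) (Nat.find (hvisit (S x))) = _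
    rw [hfind, Function.iterate_succ_apply, Automorphism.inv_apply]
    change (R.fiber (S^[Nat.find (hvisit x)] (S.inv^[Nat.find (hvisit x)] x))).comp _ = _
    rw [Function.LeftInverse.iterate S.apply_inv]
  change _ = ψ.fiber (S x) ((ψ.fiber x).inv y)
  rw [hψ]
  exact congrArg (R.fiber x) ((ψ.fiber x).apply_inv y).symm

theorem exists_isReturnTrivial_halmosDist_lt {F : ℕ → Set X} (hF : μ.MeasureDense (Set.range F))
    (B : ℕ → Set (X × X)) (hS : S.IsWeaklyMixing) (R : Extension S) {ε : ℝ} (hε : 0 < ε) :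
    ∃ R' : Extension S, IsReturnTrivial F R' ∧
      halmosDist B R.toAutomorphism R'.toAutomorphism < ε := by
  obtain ⟨j, hj⟩ := hS.exists_tendsto
  have herg : Ergodic S μ := ergodic_of_mixing_sequence S.preserves j fun E hE => hj E E hE hE
  have hV : Ergodic S.inv μ := Ergodic.symm (e := S.toMeasurableEquiv) herg
  rcases measureReal_trivial_or_exists_small S.preserves.measurable hj with h | h
  · refine ⟨R, isReturnTrivial_of_trivial_measure (fun i => hF.measurable _ ⟨i, rfl⟩) h R, ?_⟩
    have := halmosDist_le_of_agree (B := B) (R := R) (R' := R) MeasurableSet.empty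
      fun x _ y => rfl
    simp only [measureReal_empty, mul_zero] at this
    exact this.trans_lt hε
  · obtain ⟨E, hE, hE0, hEε⟩ := h (ε / 4) (by positivity)
    obtain ⟨E', hE', hEE', hvisit⟩ := exists_sweeping_set hV hE hE0
    obtain ⟨ψ, hψ⟩ := R.exists_coboundary_agree hE' hvisit
    refine ⟨coboundary S ψ, isReturnTrivial_coboundary hF ψ, ?_⟩
    refine (halmosDist_le_of_agree (S.measurableSet_preimage hE') hψ).trans_lt ?_
    rw [S.measureReal_preimage, hEE']
    linarith

end Extension

/-! ### Recurrence and genericity -/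

/-- Quantitative Poincaré recurrence along multiples of `q`. -/
theorem exists_measureReal_inter_preimage_pos {X : Type*} [MeasurableSpace X] {μ : Measure X}
    [IsProbabilityMeasure μ] {T : X → X} (hT : MeasurePreserving T μ μ) {Q : Set X}
    (hQ : MeasurableSet Q) (q : ℕ) {K : ℕ} (hK : 1 < K * μ.real Q) :
    ∃ d, 1 ≤ d ∧ d < K ∧ 0 < μ.real (Q ∩ T^[q * d] ⁻¹' Q) := by
  by_contra! hcon
  -- Otherwise the `K` sets `T^{-qi} Q` are almost disjoint with total measure above one.
  have hdis : ∀ i i', i < i' → i' < K → μ (T^[q * i] ⁻¹' Q ∩ T^[q * i'] ⁻¹' Q) = 0 := by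
    intro i i' hi hi'
    have h1 := hcon (i' - i) (by omega) (by omega)
    have h2 : T^[q * i] ⁻¹' Q ∩ T^[q * i'] ⁻¹' Q =
        T^[q * i] ⁻¹' (Q ∩ T^[q * (i' - i)] ⁻¹' Q) := by
      rw [Set.preimage_inter, ← Set.preimage_comp, ← Function.iterate_add, ← mul_add,
        Nat.sub_add_cancel hi.le]
    rw [h2, (hT.iterate _).measure_preimage
      (hQ.inter ((hT.iterate _).measurable hQ)).nullMeasurableSet, ← measureReal_eq_zero_iff]
    exact le_antisymm h1 measureReal_nonneg
  have hsum : μ (⋃ i ∈ Finset.range K, T^[q * i] ⁻¹' Q) =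
      ∑ i ∈ Finset.range K, μ (T^[q * i] ⁻¹' Q) := by
    refine measure_biUnion_finset₀ (fun i hi i' hi' hne => ?_)
      fun i _ => ((hT.iterate _).measurable hQ).nullMeasurableSet
    have hi1 := Finset.mem_range.1 (Finset.mem_coe.1 hi)
    have hi2 := Finset.mem_range.1 (Finset.mem_coe.1 hi')
    rcases lt_or_gt_of_ne hne with hlt | hlt
    · exact hdis i i' hlt hi2
    · exact AEDisjoint.symm (hdis i' i hlt hi1)
  simp only [(hT.iterate _).measure_preimage hQ.nullMeasurableSet, Finset.sum_const,
    Finset.card_range, nsmul_eq_mul] at hsum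
  have h1 : (K : ENNReal) * μ Q ≤ 1 := hsum ▸ prob_le_one
  have h2 := ENNReal.toReal_mono ENNReal.one_ne_top h1
  rw [ENNReal.toReal_mul, ENNReal.toReal_natCast, ENNReal.toReal_one] at h2
  exact absurd h2 (not_le.2 hK)

theorem measureReal_sdiff_pos {X : Type*} [MeasurableSpace X] {μ : Measure X}
    [IsFiniteMeasure μ] {Q Z W : Set X} (h : μ.real Z < μ.real Q) (hsub : Q \ Z ⊆ W) :
    0 < μ.real W := by
  have h1 : Q ⊆ W ∪ Z := fun x hx => by
    by_cases hZ : x ∈ Z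
    · exact .inr hZ
    · exact .inl (hsub ⟨hx, hZ⟩)
  linarith [(measureReal_mono (μ := μ) h1).trans (measureReal_union_le _ _)]

namespace Extension

variable {X : Type*} [MeasurableSpace X] {μ : Measure X} [IsProbabilityMeasure μ]
  {S : Automorphism μ}

/-- Finitely many pieces cover the space up to `η/2`, so by pigeonhole one of them meets `A` in a
definite amount. The bound `c` does not depend on `A`, which makes the corollary uniform in `A`. -/
theorem IsReturnTrivial.exists_large_piece {F : ℕ → Set X} {R₀ : Extension S}
    (hR₀ : IsReturnTrivial F R₀) (m : ℕ) {η : ℝ} (hη : 0 < η) :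
    ∃ c > 0, ∀ A, MeasurableSet A → η ≤ μ.real A → ∃ Q ⊆ A, MeasurableSet Q ∧ c ≤ μ.real Q ∧
      ∀ x p, x ∈ Q → S^[p] x ∈ Q → AlmostFixes F m (R₀.cocycle x p) := by
  obtain ⟨D, hDm, hDU, hD⟩ := hR₀ m
  have h1 : Tendsto (fun n => μ.real (Set.accumulate D n)) atTop (𝓝 1) := by
    have := (ENNReal.tendsto_toReal (measure_ne_top μ _)).comp
      (tendsto_measure_iUnion_accumulate (μ := μ) (f := D))
    rw [hDU, measure_univ, ENNReal.toReal_one] at this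
    exact this
  obtain ⟨n, hn⟩ := (h1.eventually_const_lt (show 1 - η / 2 < 1 by linarith)).exists
  refine ⟨η / (2 * (n + 1)), by positivity, fun A hA hAη => ?_⟩
  obtain ⟨l, hl⟩ : ∃ l, η / (2 * (n + 1)) ≤ μ.real (A ∩ D l) := by
    by_contra! hcon
    have hacc : MeasurableSet (Set.accumulate D n) :=
      MeasurableSet.biUnion (Set.to_countable _) fun l _ => hDm l
    have hsub : A ⊆ (⋃ l ∈ Finset.range (n + 1), A ∩ D l) ∪ (Set.accumulate D n)ᶜ := by
      intro x hx
      by_cases hxn : x ∈ Set.accumulate D n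
      · obtain ⟨l, hl, hxl⟩ := Set.mem_accumulate.1 hxn
        refine .inl (Set.mem_iUnion₂.2 ⟨l, Finset.mem_range.2 (by omega), hx, hxl⟩)
      · exact .inr hxn
    have h2 := (measureReal_mono (μ := μ) hsub (measure_ne_top _ _)).trans
      ((measureReal_union_le _ _).trans
      (add_le_add_left (measureReal_biUnion_finset_le _ _) _))
    rw [probReal_compl_eq_one_sub hacc] at h2
    have h3 : ∑ l ∈ Finset.range (n + 1), μ.real (A ∩ D l) ≤ η / 2 := by
      have := Finset.sum_le_card_nsmul (Finset.range (n + 1)) (fun l => μ.real (A ∩ D l)) _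
        fun l _ => (hcon l).le
      rw [Finset.card_range, nsmul_eq_mul] at this
      refine this.trans_eq ?_
      push_cast
      field_simp
    linarith
  exact ⟨A ∩ D l, Set.inter_subset_left, hA.inter (hDm l), hl,
    fun x p hx hpx => hD l x p hx.2 hpx.2⟩

variable [StandardBorelSpace X]

/-- Each `W i` is a neighbourhood of every point of the dense set `D`, so all the interiors, and
even their intersection, contain `D`; no completeness of `Ext(S)` is needed. -/
theorem isTypical_of_iInter_subset {B : ℕ → Set (X × X)} {ι : Type*} [Countable ι]
    {W : ι → Set (Extension S)} {V D : Set (Extension S)}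
    (hD : ∀ R : Extension S, ∀ ε > 0, ∃ R' ∈ D,
      halmosDist B R.toAutomorphism R'.toAutomorphism < ε)
    (hW : ∀ i, ∀ R₀ ∈ D, ∀ᶠ R in comap (fun R : Extension S =>
      halmosDist B R.toAutomorphism R₀.toAutomorphism) (𝓝 0), R ∈ W i)
    (hV : ⋂ i, W i ⊆ V) : IsTypical B V := by
  let _ : PseudoMetricSpace (Extension S) :=
    PseudoMetricSpace.induced toAutomorphism (halmosPseudoMetric B)
  refine ⟨⋂ i, interior (W i),
    (Set.iInter_mono fun i => interior_subset).trans hV,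
    IsGδ.iInter_of_isOpen fun i => isOpen_interior, ?_⟩
  have hDd : Dense D := fun R => Metric.mem_closure_iff.2 fun ε hε => hD R ε hε
  refine hDd.mono fun R₀ hR₀ => Set.mem_iInter.2 fun i => ?_
  rw [mem_interior_iff_mem_nhds, ← nhds_comap_dist]
  exact hW i R₀ hR₀

theorem isTypical_RC {F : ℕ → Set X} (hF : μ.MeasureDense (Set.range F))
    {B : ℕ → Set (X × X)} (hB : (μ.prod μ).MeasureDense (Set.range B))
    (hS : S.IsWeaklyMixing) {P : ℕ → Finset ℕ}
    (hP : ∀ D : Set X, MeasurableSet D → 0 < μ D →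
      ∀ᶠ j in atTop, ∀ p ∈ P j, 0 < μ.real (D ∩ S^[p] ⁻¹' D))
    {A : Set X} (hA : MeasurableSet A) (hA0 : 0 < μ A) : IsTypical B (RC S F P A) := by
  have hFm : ∀ k, MeasurableSet (F k) := fun k => hF.measurable _ ⟨k, rfl⟩
  refine isTypical_of_iInter_subset (ι := ℕ × ℕ)
    (W := fun i => {R | 1 ≤ i.1 → ∃ j > i.2, 0 < phi F P A i.1 j R})
    (D := {R | IsReturnTrivial F R})
    (fun R ε hε => exists_isReturnTrivial_halmosDist_lt hF B hS R hε) ?_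
    fun R hR N hN j₀ => Set.mem_iInter.1 hR (N, j₀) hN
  rintro ⟨N, j₀⟩ R₀ hR₀
  rcases Nat.eq_zero_or_pos N with rfl | hN
  · exact .of_forall fun R h => absurd h (by norm_num)
  have hN' : (0 : ℝ) < 1 / N := by positivity
  obtain ⟨m, hm⟩ := exists_almostFixes_imp_halmosDist_lt (ν := μ) F hN'
  obtain ⟨D, hDm, hDU, hD⟩ := hR₀ (2 * m + 1)
  obtain ⟨l, hl⟩ : ∃ l, 0 < μ (A ∩ D l) := by
    by_contra! hcon
    have h1 : μ (⋃ l, A ∩ D l) = 0 := measure_iUnion_null fun l => le_antisymm (hcon l) bot_le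
    rw [← Set.inter_iUnion, hDU, Set.inter_univ] at h1
    exact hA0.ne' h1
  -- A window beyond `j₀` consisting of return times of `A ∩ D l`. It is finite, so a single
  -- neighbourhood of `R₀` keeps all the exceptional sets smaller than the return sets.
  obtain ⟨j, hj, hjP⟩ := ((eventually_gt_atTop j₀).and (hP _ (hA.inter (hDm l)) hl)).exists
  have hev := (eventually_all_finset (P j)).2 fun p hp =>
    (tendsto_measureReal_not_almostFixes hB (R := fun R : Extension S => R) (R₀ := R₀)
      tendsto_comap hFm m p).eventually_lt_const (hjP p hp)
  filter_upwards [hev] with R hR _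
  refine ⟨j, hj, Finset.prod_pos fun p hp => measureReal_sdiff_pos (hR p hp) ?_⟩
  rintro x ⟨⟨hx, hpx⟩, hxn⟩
  refine ⟨hx.1, hpx.1, hm _ ?_⟩
  by_contra hcon
  exact hxn ⟨hD l x p hx.2 hpx.2, hcon⟩

/-- Every set of measure at least `η` contains, for a set of base points of positive measure,
a return after time `j₀` at which the cocycle almost fixes the first `m` sets of `F`. -/
def IsRecurrentAt (F : ℕ → Set X) (m j₀ : ℕ) (η : ℝ) (R : Extension S) : Prop :=
  ∀ A, MeasurableSet A → η ≤ μ.real A →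
    ∃ p > j₀, 0 < μ.real {x | x ∈ A ∧ S^[p] x ∈ A ∧ AlmostFixes F m (R.cocycle x p)}

theorem IsReturnTrivial.eventually_isRecurrentAt {F : ℕ → Set X} (hF : ∀ k, MeasurableSet (F k))
    {B : ℕ → Set (X × X)} (hB : (μ.prod μ).MeasureDense (Set.range B)) {R₀ : Extension S}
    (hR₀ : IsReturnTrivial F R₀) (m j₀ : ℕ) {η : ℝ} (hη : 0 < η) :
    ∀ᶠ R in comap (fun R : Extension S =>
      halmosDist B R.toAutomorphism R₀.toAutomorphism) (𝓝 0), IsRecurrentAt F m j₀ η R := by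
  obtain ⟨c, hc, hcQ⟩ := hR₀.exists_large_piece (2 * m + 1) hη
  -- After discarding the bad set `Z`, at least `c/2` of `Q` remains, so `K > 2/c` forces a return.
  -- Multiples of `j₀ + 1` ensure that its time exceeds `j₀`.
  obtain ⟨K, hK⟩ := exists_nat_gt (2 / c)
  rw [div_lt_iff₀ hc] at hK
  have hlim : Tendsto (fun R : Extension S => ∑ d ∈ Finset.range K,
      μ.real {x | AlmostFixes F (2 * m + 1) (R₀.cocycle x ((j₀ + 1) * d)) ∧
        ¬ AlmostFixes F m (R.cocycle x ((j₀ + 1) * d))})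
      (comap (fun R : Extension S => halmosDist B R.toAutomorphism R₀.toAutomorphism) (𝓝 0))
      (𝓝 0) := by
    simpa using tendsto_finsetSum (Finset.range K) fun d _ =>
      tendsto_measureReal_not_almostFixes hB (R := fun R : Extension S => R) (R₀ := R₀)
        tendsto_comap hF m ((j₀ + 1) * d)
  filter_upwards [hlim.eventually_lt_const (half_pos hc)] with R hR A hA hAη
  obtain ⟨Q, hQA, hQ, hQc, hQR⟩ := hcQ A hA hAη
  set Z : Set X := ⋃ d ∈ Finset.range K,
    {x | AlmostFixes F (2 * m + 1) (R₀.cocycle x ((j₀ + 1) * d)) ∧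
      ¬ AlmostFixes F m (R.cocycle x ((j₀ + 1) * d))} with hZ
  have hZm : MeasurableSet Z :=
    Finset.measurableSet_biUnion _ fun d _ =>
      (R₀.measurableSet_almostFixes hF _ _).inter (R.measurableSet_almostFixes hF _ _).compl
  have hZc : μ.real Z < c / 2 := (measureReal_biUnion_finset_le _ _).trans_lt hR
  have hQZ : c / 2 ≤ μ.real (Q \ Z) := by
    have := le_measureReal_sdiff (μ := μ) (s₁ := Q) (s₂ := Z) (measure_ne_top _ _)
    linarith
  obtain ⟨d, hd1, hdK, hd⟩ := exists_measureReal_inter_preimage_pos S.preserves (hQ.diff hZm)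
    (j₀ + 1) (K := K) (by nlinarith)
  refine ⟨(j₀ + 1) * d, by nlinarith, hd.trans_le (measureReal_mono ?_)⟩
  rintro x ⟨⟨hx, hxZ⟩, ⟨hpx, -⟩⟩
  refine ⟨hQA hx, hQA hpx, ?_⟩
  by_contra hcon
  exact hxZ (Set.mem_iUnion₂.2 ⟨d, Finset.mem_range.2 hdK, hQR _ _ hx hpx, hcon⟩)

theorem ae_exists_return_of_isRecurrentAt {F : ℕ → Set X} (hF : ∀ k, MeasurableSet (F k))
    {R : Extension S} {m j₀ : ℕ} (hR : ∀ k : ℕ, IsRecurrentAt F m j₀ (1 / ((k : ℝ) + 1)) R)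
    {A : Set X} (hA : MeasurableSet A) :
    ∀ᵐ x ∂μ, x ∈ A → ∃ p > j₀, S^[p] x ∈ A ∧ AlmostFixes F m (R.cocycle x p) := by
  set Z : Set X := A ∩ ⋂ p, ⋂ (_ : p > j₀),
    (S^[p] ⁻¹' A ∩ {x | AlmostFixes F m (R.cocycle x p)})ᶜ with hZ
  have hZm : MeasurableSet Z := hA.inter <| MeasurableSet.iInter fun p => MeasurableSet.iInter
    fun _ => (((S.preserves.iterate p).measurable hA).inter
      (R.measurableSet_almostFixes hF m p)).compl
  have hZ0 : μ Z = 0 := by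
    by_contra hne
    have hpos : 0 < μ.real Z := ENNReal.toReal_pos hne (measure_ne_top _ _)
    obtain ⟨k, hk⟩ := exists_nat_one_div_lt hpos
    -- Recurrence is applied to the set `Z` of non-returning points itself: a return to `Z` is a
    -- return to `A`, a contradiction.
    obtain ⟨p, hp, hpp⟩ := hR k Z hZm hk.le
    obtain ⟨x, hx, hpx, hfix⟩ := nonempty_of_measureReal_ne_zero hpp.ne'
    exact Set.mem_iInter₂.1 hx.2 p hp ⟨hpx.1, hfix⟩
  rw [ae_iff]
  refine measure_mono_null (fun x hx => ?_) hZ0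
  simp only [Set.mem_ofPred_eq, Classical.not_imp] at hx
  exact ⟨hx.1, Set.mem_iInter₂.2 fun p hp hcon => hx.2 ⟨p, hp, hcon.1, hcon.2⟩⟩

theorem isTypical_recurrent {F : ℕ → Set X} (hF : μ.MeasureDense (Set.range F))
    {B : ℕ → Set (X × X)} (hB : (μ.prod μ).MeasureDense (Set.range B))
    (hS : S.IsWeaklyMixing) :
    IsTypical B {R : Extension S | ∀ A : Set X, MeasurableSet A → 0 < μ A → ∀ᵐ x ∂μ, x ∈ A →
      ∃ p : ℕ → ℕ, Tendsto p atTop atTop ∧ (∀ i, S^[p i] x ∈ A) ∧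
        Tendsto (fun i => halmosDist F (R.cocycle x (p i)) (Automorphism.one μ)) atTop (𝓝 0)} := by
  have hFm : ∀ k, MeasurableSet (F k) := fun k => hF.measurable _ ⟨k, rfl⟩
  refine isTypical_of_iInter_subset (ι := ℕ × ℕ × ℕ)
    (W := fun i => {R | IsRecurrentAt F i.1 i.2.1 (1 / ((i.2.2 : ℝ) + 1)) R})
    (D := {R | IsReturnTrivial F R})
    (fun R ε hε => exists_isReturnTrivial_halmosDist_lt hF B hS R hε)
    (fun i R₀ hR₀ => IsReturnTrivial.eventually_isRecurrentAt hFm hB hR₀ _ _ (by positivity)) ?_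
  intro R hR A hA _
  have h1 : ∀ᵐ x ∂μ, ∀ n : ℕ, x ∈ A → ∃ p > n, S^[p] x ∈ A ∧
      AlmostFixes F n (R.cocycle x p) :=
    ae_all_iff.2 fun n => ae_exists_return_of_isRecurrentAt hFm
      (fun k => Set.mem_iInter.1 hR (n, n, k)) hA
  filter_upwards [h1] with x hx hxA
  choose p hp hpA hfix using fun n => hx n hxA
  refine ⟨p, tendsto_atTop_mono (fun n => (hp n).le) tendsto_id, hpA, ?_⟩
  refine tendsto_order.2 ⟨fun a ha => .of_forall fun n => ha.trans_le (halmosDist_nonneg _ _ _),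
    fun ε hε => ?_⟩
  obtain ⟨m, hm⟩ := exists_almostFixes_imp_halmosDist_lt (ν := μ) F hε
  filter_upwards [eventually_ge_atTop m] with n hn
  exact hm _ ((hfix n).mono hn)

end Extension

end GenericExtension

theorem mainTheorem7 {X : Type*} [MeasurableSpace X] [StandardBorelSpace X]
    (μ : Measure X) [IsProbabilityMeasure μ]
    (F : ℕ → Set X) (hF : μ.MeasureDense (Set.range F))
    (B : ℕ → Set (X × X)) (hB : (μ.prod μ).MeasureDense (Set.range B))
    (S : GenericExtension.Automorphism μ) (hS : S.IsWeaklyMixing) :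
    (∀ A : Set X, MeasurableSet A → 0 < μ A →
      ∃ P : ℕ → Finset ℕ,
        (∀ j, P j ⊆ Finset.Icc j (2 * j)) ∧
        Tendsto (fun j : ℕ => ((P j).card : ℝ) / (j : ℝ)) atTop (𝓝 1) ∧
        GenericExtension.Extension.IsTypical B (GenericExtension.Extension.RC S F P A)) ∧
    GenericExtension.Extension.IsTypical B
      {R : GenericExtension.Extension S |
        ∀ A : Set X, MeasurableSet A → 0 < μ A → ∀ᵐ x ∂μ, x ∈ A →
          ∃ p : ℕ → ℕ, Tendsto p atTop atTop ∧ (∀ i, S^[p i] x ∈ A) ∧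
            Tendsto (fun i => GenericExtension.halmosDist F (R.cocycle x (p i))
              (GenericExtension.Automorphism.one μ)) atTop (𝓝 0)} := by
  obtain ⟨j, hj⟩ := hS.exists_tendsto
  have herg := GenericExtension.ergodic_of_mixing_sequence S.preserves j
    fun E hE => hj E E hE hE
  have herg2 := GenericExtension.ergodic_of_mixing_sequence (S.preserves.prod S.preserves) j
    fun E hE => GenericExtension.prod_mixing_sequence S.preserves j hj hE hE
  obtain ⟨P, hP1, hP2, hP3⟩ :=
    GenericExtension.exists_windows_measure_inter_pos herg herg2 hF
  exact ⟨fun A hA hA0 => ⟨P, hP1, hP2,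
      GenericExtension.Extension.isTypical_RC hF hB hS hP3 hA hA0⟩,
    GenericExtension.Extension.isTypical_recurrent hF hB hS⟩
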